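/- Let $Q$ be a smooth $n$-manifold (Hausdorff, second countable) and $\mathcal D\to Q$ a smooth vector bundle of rank $m$ with a skew-symmetric algebroid structure: a smooth bundle map $\rho:\mathcal D\to TQ$ over the identity (the anchor) and a skew-symmetric $\mathbb R$-bilinear bracket $[\![\cdot,\cdot]\!]$ on $\Gamma(\mathcal D)$ with $[\![X,fY]\!]=f[\![X,Y]\!]+\rho(X)(f)\,Y$. Let a fully actuated nonholonomic mechanical control system on $\mathcal D$ be given: a smooth symmetric nondegenerate bundle metric $\mathcal G$ on $\mathcal D$, a potential $V\in C^\infty(Q)$ and input sections $Y_1,\dots,Y_m\in\Gamma(\mathcal D)$ that form a basis of every fibre. Let $\nabla$ be the Levi-Civita connection of $\mathcal G$, defined by the Koszul formula $$2\mathcal G(\nabla_XY,Z)=\rho(X)(\mathcal G(Y,Z))+\rho(Y)(\mathcal G(X,Z))-\rho(Z)(\mathcal G(X,Y))+\mathcal G(X,[\![Z,Y]\!])+\mathcal G(Y,[\![Z,X]\!])-\mathcal G(Z,[\![Y,X]\!]),$$ let $\mathcal G(\operatorname{grad}V,X)=\rho(X)(V)$, let $\mathcal G_{AB}=\mathcal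 G(Y_A,Y_B)$ with inverse matrix $(\mathcal G^{AB})$, and $\nabla_{Y_A}Y_B=\Gamma^C_{AB}Y_C$. Write $y^A$ for the fibre coordinates on $\mathcal D$ in the frame $\{Y_A\}$. Let $U\subseteq\mathbb R^m$ be open, $C:\mathcal D\times U\to\mathbb R$ a smooth cost and $T>0$. A $C^1$ curve $\gamma:[0,T]\to\mathcal D$ over $q:[0,T]\to Q$ is $\rho$-admissible if $\dot q=\rho(\gamma)$. A solution of the control problem is a pair $(\gamma,u)$ with $\gamma$ a $\rho$-admissible $C^1$ curve and $u:[0,T]\to U$ such that $\nabla_\gamma\gamma+\operatorname{grad}V(q)=u^AY_A(q)$. It is optimal if it minimizes $\mathcal J(\gamma,u)=\int_0^TC(\gamma,u)\,dt$ among all solutions with the same end points $\gamma(0),\gamma(T)\in\mathcal D$ whose graph $t\mapsto(t,\gamma(t),u(t))$ stays in some fixed neighbourhood of its own graph (weak local minimizer; in particular every global minimizer). Fix a chart $(q^i)$ of $Q$, consider only curves $\gamma$ whose base curve stays in its domain, write $\rho(Y_A)=\rho^i_A\,\partial/\partial q^i$, and let $$\mathcal L(q,y,\dot y)=C\Big(q,y,\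 \dot y^C+\Gamma^C_{AB}y^Ay^B+\mathcal G^{CB}\rho^i_B\frac{\partial V}{\partial q^i}\Big)$$ be the cost with the controls eliminated, in the coordinates $(q^i,y^A,\dot y^A)$ of $\mathcal D^{(2)}=\{\dot q^i=\rho^i_Ay^A\}\subset T\mathcal D$. For $\mu_0\in\{0,1\}$ and a continuous curve $\lambda:[0,T]\to\mathbb R^n$ call $(\gamma,\lambda)$ $\mu_0$-stationary if it is a stationary point of $$\int_0^T\big(\mu_0\mathcal L(q,y,\dot y)+\lambda_i(\dot q^i-\rho^i_A(q)y^A)\big)\,dt$$ for all $C^1$ variations of $(q,y)$ with fixed end points and all continuous variations of $\lambda$. Call $\gamma$ a normal extremal with multipliers $\lambda$ if $(\gamma,\lambda)$ is $1$-stationary, and an abnormal extremal with multipliers $\lambda$ if it is $0$-stationary and $\lambda\not\equiv0$. Then: 1. Let $\gamma=(q,y)$ be a $C^1$ curve whose eliminated control $\dot y^C+\Gamma^C_{AB}y^Ay^B+\mathcal G^{CB}\rho^i_B\,\partial V/\partial q^i$ takes values in $U$, and let $\lambda:[0,T]\to\mathbb R^n$. Then $\gamma$ is a normal extremal with multipliers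 $\lambda$ if and only if $\gamma$ is $\rho$-admissible and, on $[0,T]$ (the left-hand sides being differentiable), $$\dot\lambda_i=\frac{\partial\mathcal L}{\partial q^i}-\lambda_j\frac{\partial\rho^j_A}{\partial q^i}y^A,\qquad \frac{d}{dt}\Big(\frac{\partial\mathcal L}{\partial\dot y^A}\Big)=\frac{\partial\mathcal L}{\partial y^A}-\rho^i_A\lambda_i,\qquad \dot q^i=\rho^i_Ay^A.$$ 2. If $(\gamma,u)$ is optimal, then $\gamma$ is a normal or an abnormal extremal. In particular, if $\gamma$ is not an abnormal extremal, there are multipliers $\lambda_i$ such that the equations of 1 hold. -/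

import Mathlib

open Bundle Set MeasureTheory
open scoped Manifold ContDiff Topology

noncomputable section

namespace NonholonomicControl

/-- A skew-symmetric algebroid structure on a rank `m` real smooth vector bundle `D` over an
`n`-dimensional manifold `Q`: a smooth fibrewise linear anchor `ρ : D → TQ` over the identity and a
skew-symmetric `ℝ`-bilinear bracket of smooth sections that satisfies the Leibniz rule
`⟦X, f Y⟧ = f ⟦X, Y⟧ + ρ(X)(f) Y`. The Jacobi identity is not required. -/
structure SkewAlgebroid (n m : ℕ) (Q : Type*) [TopologicalSpace Q]
    [ChartedSpace (EuclideanSpace ℝ (Fin n)) Q] [IsManifold (𝓡 n) ∞ Q]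
    (D : Q → Type*) [TopologicalSpace (TotalSpace (EuclideanSpace ℝ (Fin m)) D)]
    [∀ x, AddCommGroup (D x)] [∀ x, Module ℝ (D x)] [∀ x, TopologicalSpace (D x)]
    [FiberBundle (EuclideanSpace ℝ (Fin m)) D] [VectorBundle ℝ (EuclideanSpace ℝ (Fin m)) D]
    [ContMDiffVectorBundle ∞ (EuclideanSpace ℝ (Fin m)) D (𝓡 n)] where
  /-- the anchor map -/
  anchor : ∀ x : Q, D x →ₗ[ℝ] TangentSpace (𝓡 n) x
  anchor_smooth : ContMDiff ((𝓡 n).prod 𝓘(ℝ, EuclideanSpace ℝ (Fin m))) (𝓡 n).tangent ∞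
    (fun v : TotalSpace (EuclideanSpace ℝ (Fin m)) D =>
      (⟨v.proj, anchor v.proj v.snd⟩ : TangentBundle (𝓡 n) Q))
  /-- the bracket of smooth sections -/
  bracket : Cₛ^∞⟮𝓡 n; EuclideanSpace ℝ (Fin m), D⟯ →ₗ[ℝ]
    Cₛ^∞⟮𝓡 n; EuclideanSpace ℝ (Fin m), D⟯ →ₗ[ℝ] Cₛ^∞⟮𝓡 n; EuclideanSpace ℝ (Fin m), D⟯
  bracket_skew : ∀ X Y, bracket X Y = -bracket Y X
  leibniz : ∀ (f : C^∞⟮𝓡 n, Q; ℝ⟯) (X Y fY : Cₛ^∞⟮𝓡 n; EuclideanSpace ℝ (Fin m), D⟯),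
    (∀ x, fY x = f x • Y x) →
      ∀ x, bracket X fY x =
        f x • bracket X Y x + (show ℝ from mfderiv (𝓡 n) 𝓘(ℝ, ℝ) f x (anchor x (X x))) • Y x

/-- A fully actuated nonholonomic mechanical control system on a skew-symmetric algebroid:
a nondegenerate bundle metric `𝒢` on `D`, a potential `V`, and `m = rank D` input sections
`Y₁, …, Yₘ` that span `D`. -/
structure System (n m : ℕ) (Q : Type*) [TopologicalSpace Q]
    [ChartedSpace (EuclideanSpace ℝ (Fin n)) Q] [IsManifold (𝓡 n) ∞ Q]
    (D : Q → Type*) [TopologicalSpace (TotalSpace (EuclideanSpace ℝ (Fin m)) D)]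
    [∀ x, AddCommGroup (D x)] [∀ x, Module ℝ (D x)] [∀ x, TopologicalSpace (D x)]
    [FiberBundle (EuclideanSpace ℝ (Fin m)) D] [VectorBundle ℝ (EuclideanSpace ℝ (Fin m)) D]
    [ContMDiffVectorBundle ∞ (EuclideanSpace ℝ (Fin m)) D (𝓡 n)]
    extends SkewAlgebroid n m Q D where
  /-- the bundle metric on `D` -/
  metric : ∀ x : Q, D x →ₗ[ℝ] D x →ₗ[ℝ] ℝ
  metric_symm : ∀ x v w, metric x v w = metric x w v
  metric_nondegenerate : ∀ x v, (∀ w, metric x v w = 0) → v = 0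
  metric_smooth : ∀ X Y : Cₛ^∞⟮𝓡 n; EuclideanSpace ℝ (Fin m), D⟯,
    ContMDiff (𝓡 n) 𝓘(ℝ, ℝ) ∞ (fun x => metric x (X x) (Y x))
  /-- the potential energy -/
  V : C^∞⟮𝓡 n, Q; ℝ⟯
  /-- the input sections -/
  input : Fin m → Cₛ^∞⟮𝓡 n; EuclideanSpace ℝ (Fin m), D⟯
  input_linearIndependent : ∀ x, LinearIndependent ℝ (fun A => input A x)
  input_span : ∀ x, ⊤ ≤ Submodule.span ℝ (range fun A => input A x)

variable {n m : ℕ} {Q : Type*} [TopologicalSpace Q]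
    [ChartedSpace (EuclideanSpace ℝ (Fin n)) Q] [IsManifold (𝓡 n) ∞ Q]
    {D : Q → Type*} [TopologicalSpace (TotalSpace (EuclideanSpace ℝ (Fin m)) D)]
    [∀ x, AddCommGroup (D x)] [∀ x, Module ℝ (D x)] [∀ x, TopologicalSpace (D x)]
    [FiberBundle (EuclideanSpace ℝ (Fin m)) D] [VectorBundle ℝ (EuclideanSpace ℝ (Fin m)) D]
    [ContMDiffVectorBundle ∞ (EuclideanSpace ℝ (Fin m)) D (𝓡 n)]

namespace System

variable (S : System n m Q D)

/-- The basis `Y₁(x), …, Yₘ(x)` of the fibre `D x`. -/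
def frame (x : Q) : Module.Basis (Fin m) ℝ (D x) :=
  Module.Basis.mk (S.input_linearIndependent x) (S.input_span x)

/-- The fibre coordinates `y^A` of a point of `D` in the frame of the input sections. -/
def coord (v : TotalSpace (EuclideanSpace ℝ (Fin m)) D) : Fin m → ℝ :=
  fun A => (S.frame v.proj).repr v.snd A

/-- The point of `D` over `x` with fibre coordinates `y`, that is `y^A Y_A(x)`. -/
def point (x : Q) (y : Fin m → ℝ) : TotalSpace (EuclideanSpace ℝ (Fin m)) D :=
  ⟨x, ∑ A, y A • S.input A x⟩

/-- `ρ(X)(f)` for a section `X` and a function `f`. -/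
def lieDeriv (X : Cₛ^∞⟮𝓡 n; EuclideanSpace ℝ (Fin m), D⟯) (f : Q → ℝ) (x : Q) : ℝ :=
  mfderiv (𝓡 n) 𝓘(ℝ, ℝ) f x (S.anchor x (X x))

/-- The Gram matrix `𝒢_AB = 𝒢(Y_A, Y_B)`. -/
def gram (x : Q) : Matrix (Fin m) (Fin m) ℝ :=
  fun A B => S.metric x (S.input A x) (S.input B x)

/-- The right-hand side of the Koszul formula for `2 𝒢(∇_X Y, Z)`. -/
def koszul (X Y Z : Cₛ^∞⟮𝓡 n; EuclideanSpace ℝ (Fin m), D⟯) (x : Q) : ℝ :=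
  S.lieDeriv X (fun p => S.metric p (Y p) (Z p)) x
    + S.lieDeriv Y (fun p => S.metric p (X p) (Z p)) x
    - S.lieDeriv Z (fun p => S.metric p (X p) (Y p)) x
    + S.metric x (X x) (S.bracket Z Y x)
    + S.metric x (Y x) (S.bracket Z X x)
    - S.metric x (Z x) (S.bracket Y X x)

/-- The Levi-Civita connection of `𝒢`: the value of `∇_X Y` at `x`, obtained by solving the Koszul
formula in the frame of the input sections. -/
def leviCivita (X Y : Cₛ^∞⟮𝓡 n; EuclideanSpace ℝ (Fin m), D⟯) (x : Q) : D x :=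
  ∑ C, ((1 / 2 : ℝ) * ∑ B, (S.gram x)⁻¹ C B * S.koszul X Y (S.input B) x) • S.input C x

/-- The Christoffel symbols, `∇_{Y_A} Y_B = Γ^C_AB Y_C`. -/
def christoffel (A B C : Fin m) (x : Q) : ℝ :=
  (S.frame x).repr (S.leviCivita (S.input A) (S.input B) x) C

/-- The gradient section of the potential, `(grad V)^C = 𝒢^{CB} ρ(Y_B)(V)`. -/
def gradV (x : Q) : D x :=
  ∑ C, (∑ B, (S.gram x)⁻¹ C B * S.lieDeriv (S.input B) S.V x) • S.input C x

theorem gram_isUnit (x : Q) : IsUnit (S.gram x).det := by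
  rw [isUnit_iff_ne_zero]
  intro h
  obtain ⟨v, hv, hv0⟩ := Matrix.exists_vecMul_eq_zero_iff.2 h
  apply hv
  have hz : ∑ A, v A • S.input A x = 0 := by
    apply S.metric_nondegenerate x
    intro w
    have hlin : S.metric x (∑ A, v A • S.input A x) = 0 := by
      apply (S.frame x).ext
      intro B
      have := congrFun hv0 B
      simpa [frame, Matrix.vecMul, dotProduct, gram] using this
    rw [hlin]; rfl
  exact funext (Fintype.linearIndependent_iff.1 (S.input_linearIndependent x) v hz)

theorem metric_leviCivita (X Y : Cₛ^∞⟮𝓡 n; EuclideanSpace ℝ (Fin m), D⟯) (B : Fin m) (x : Q) :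
    2 * S.metric x (S.leviCivita X Y x) (S.input B x) = S.koszul X Y (S.input B) x := by
  have hg : ∀ i, ∑ C, S.gram x B C * (S.gram x)⁻¹ C i = if B = i then 1 else 0 := by
    intro i
    have := congrFun (congrFun (Matrix.mul_nonsing_inv _ (S.gram_isUnit x)) B) i
    simpa [Matrix.mul_apply, Matrix.one_apply] using this
  rw [S.metric_symm]
  simp only [leviCivita, map_sum, map_smul, smul_eq_mul]
  calc _ = ∑ i, (∑ C, S.gram x B C * (S.gram x)⁻¹ C i) * S.koszul X Y (S.input i) x := by
        simp only [Finset.mul_sum, Finset.sum_mul, gram]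
        rw [Finset.sum_comm]
        refine Finset.sum_congr rfl fun _ _ => Finset.sum_congr rfl fun _ _ => ?_
        ring
    _ = _ := by simp [hg]

theorem metric_gradV (B : Fin m) (x : Q) :
    S.metric x (S.gradV x) (S.input B x) = S.lieDeriv (S.input B) S.V x := by
  have hg : ∀ i, ∑ C, S.gram x B C * (S.gram x)⁻¹ C i = if B = i then 1 else 0 := by
    intro i
    have := congrFun (congrFun (Matrix.mul_nonsing_inv _ (S.gram_isUnit x)) B) i
    simpa [Matrix.mul_apply, Matrix.one_apply] using this
  rw [S.metric_symm]
  simp only [gradV, map_sum, map_smul, smul_eq_mul]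
  calc _ = ∑ i, (∑ C, S.gram x B C * (S.gram x)⁻¹ C i) * S.lieDeriv (S.input i) S.V x := by
        simp only [Finset.sum_mul, gram]
        rw [Finset.sum_comm]
        refine Finset.sum_congr rfl fun _ _ => Finset.sum_congr rfl fun _ _ => ?_
        ring
    _ = _ := by simp [hg]

/-- Derivative of the fibre coordinates along a curve in `D` on `[0, T]`. -/
def ydot (T : ℝ) (γ : ℝ → TotalSpace (EuclideanSpace ℝ (Fin m)) D) (t : ℝ) : Fin m → ℝ :=
  derivWithin (fun s => S.coord (γ s)) (Icc 0 T) t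

/-- The covariant derivative `∇_γ γ` of a curve in `D` along itself:
`ẏ^A Y_A + y^A y^B ∇_{Y_A} Y_B`. -/
def accel (T : ℝ) (γ : ℝ → TotalSpace (EuclideanSpace ℝ (Fin m)) D) (t : ℝ) : D (γ t).proj :=
  ∑ A, S.ydot T γ t A • S.input A (γ t).proj
    + ∑ A, ∑ B, (S.coord (γ t) A * S.coord (γ t) B) •
        S.leviCivita (S.input A) (S.input B) (γ t).proj

/-- `γ` is a `C¹` curve in `D` on `[0, T]`. -/
def IsC1 (T : ℝ) (γ : ℝ → TotalSpace (EuclideanSpace ℝ (Fin m)) D) : Prop :=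
  ContMDiffOn 𝓘(ℝ, ℝ) ((𝓡 n).prod 𝓘(ℝ, EuclideanSpace ℝ (Fin m))) 1 γ (Icc 0 T)

/-- `γ` is `ρ`-admissible on `[0, T]`: the velocity of its base curve is `ρ(γ(t))`. -/
def IsAdmissible (T : ℝ) (γ : ℝ → TotalSpace (EuclideanSpace ℝ (Fin m)) D) : Prop :=
  ∀ t ∈ Icc 0 T, HasMFDerivWithinAt 𝓘(ℝ, ℝ) (𝓡 n) (fun s => (γ s).proj) (Icc 0 T) t
    ((1 : ℝ →L[ℝ] ℝ).smulRight (S.anchor (γ t).proj (γ t).snd))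

/-- `(γ, u)` is a solution on `[0, T]` of the fully actuated nonholonomic control problem with
control set `U`: `γ` is a `ρ`-admissible `C¹` curve, `u` takes values in `U` and
`∇_γ γ + grad V = u^A Y_A`. -/
structure IsSolution (U : Set (Fin m → ℝ)) (T : ℝ)
    (γ : ℝ → TotalSpace (EuclideanSpace ℝ (Fin m)) D) (u : ℝ → Fin m → ℝ) : Prop where
  isC1 : IsC1 (n := n) T γ
  admissible : S.IsAdmissible T γ
  control_mem : ∀ t ∈ Icc 0 T, u t ∈ U
  motion : ∀ t ∈ Icc 0 T,
    S.accel T γ t + S.gradV (γ t).proj = ∑ A, u t A • S.input A (γ t).proj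

/-- The cost functional `𝒥(γ, u) = ∫₀ᵀ C(γ(t), u(t)) dt`. -/
def cost (C : TotalSpace (EuclideanSpace ℝ (Fin m)) D × (Fin m → ℝ) → ℝ) (T : ℝ)
    (γ : ℝ → TotalSpace (EuclideanSpace ℝ (Fin m)) D) (u : ℝ → Fin m → ℝ) : ℝ :=
  ∫ t in (0 : ℝ)..T, C (γ t, u t)

/-- `(γ, u)` is a (weak local) solution of the optimal control problem: it minimizes the cost among
all solutions of the control problem with the same boundary conditions in `D` whose graph
`t ↦ (t, γ'(t), u'(t))` stays in some open neighbourhood `W` of the graph of `(γ, u)`. A global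
minimizer is the case `W = univ`. -/
def IsOptimal (U : Set (Fin m → ℝ))
    (C : TotalSpace (EuclideanSpace ℝ (Fin m)) D × (Fin m → ℝ) → ℝ) (T : ℝ)
    (γ : ℝ → TotalSpace (EuclideanSpace ℝ (Fin m)) D) (u : ℝ → Fin m → ℝ) : Prop :=
  S.IsSolution U T γ u ∧
    ∃ W : Set (ℝ × TotalSpace (EuclideanSpace ℝ (Fin m)) D × (Fin m → ℝ)), IsOpen W ∧
      (∀ t ∈ Icc 0 T, (t, γ t, u t) ∈ W) ∧
      ∀ (γ' : ℝ → TotalSpace (EuclideanSpace ℝ (Fin m)) D) (u' : ℝ → Fin m → ℝ),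
        S.IsSolution U T γ' u' → γ' 0 = γ 0 → γ' T = γ T →
        (∀ t ∈ Icc 0 T, (t, γ' t, u' t) ∈ W) →
        cost C T γ u ≤ cost C T γ' u'

/-- The control expressed through `(q, y, ẏ)`:
`u^C = ẏ^C + Γ^C_AB y^A y^B + 𝒢^{CB} ρ_B^i ∂V/∂q^i`. -/
def elimControl (x : Q) (y v : Fin m → ℝ) : Fin m → ℝ :=
  fun C => v C + ∑ A, ∑ B, S.christoffel A B C x * y A * y B + (S.frame x).repr (S.gradV x) C

section Coordinates

variable (φ : OpenPartialHomeomorph Q (EuclideanSpace ℝ (Fin n)))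

/-- The components `ρ_A^i` of `ρ(Y_A)` in the coordinates `φ`. -/
def anchorCoeff (A : Fin m) (i : Fin n) (x : EuclideanSpace ℝ (Fin n)) : ℝ :=
  (show EuclideanSpace ℝ (Fin n) from
    mfderiv (𝓡 n) 𝓘(ℝ, EuclideanSpace ℝ (Fin n)) φ (φ.symm x)
      (S.anchor (φ.symm x) (S.input A (φ.symm x)))) i

/-- The Lagrangian `ℒ(q, y, ẏ)` on `D^(2)`, in the coordinates `(q^i, y^A, ẏ^A)`: the cost with the
controls eliminated. -/
def lagrangian (C : TotalSpace (EuclideanSpace ℝ (Fin m)) D × (Fin m → ℝ) → ℝ)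
    (x : EuclideanSpace ℝ (Fin n)) (y v : Fin m → ℝ) : ℝ :=
  C (S.point (φ.symm x) y, S.elimControl (φ.symm x) y v)

/-- The extended Lagrangian `μ₀ ℒ(q, y, ẏ) + λ_i (q̇^i - ρ_A^i(q) y^A)`; the normal case is
`μ₀ = 1`. -/
def extLagrangian (C : TotalSpace (EuclideanSpace ℝ (Fin m)) D × (Fin m → ℝ) → ℝ) (μ₀ : ℝ)
    (x : EuclideanSpace ℝ (Fin n)) (y : Fin m → ℝ) (w : EuclideanSpace ℝ (Fin n)) (v : Fin m → ℝ)
    (lam : Fin n → ℝ) : ℝ :=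
  μ₀ * S.lagrangian φ C x y v + ∑ i, lam i * (w i - ∑ A, S.anchorCoeff φ A i x * y A)

/-- The action of the extended Lagrangian along curves `x`, `y`, `lam` on `[0, T]`. -/
def extAction (C : TotalSpace (EuclideanSpace ℝ (Fin m)) D × (Fin m → ℝ) → ℝ) (μ₀ T : ℝ)
    (x : ℝ → EuclideanSpace ℝ (Fin n)) (y : ℝ → Fin m → ℝ) (lam : ℝ → Fin n → ℝ) : ℝ :=
  ∫ t in (0 : ℝ)..T, S.extLagrangian φ C μ₀ (x t) (y t)
    (derivWithin x (Icc 0 T) t) (derivWithin y (Icc 0 T) t) (lam t)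

/-- The coordinates `q^i(t)` of the base curve of `γ`. -/
def basePath (γ : ℝ → TotalSpace (EuclideanSpace ℝ (Fin m)) D) (t : ℝ) :
    EuclideanSpace ℝ (Fin n) :=
  φ (γ t).proj

/-- `lam` is a continuous multiplier curve such that `(γ, lam)` is a stationary point of the action
of the extended Lagrangian, for all variations of `(q, y)` with fixed end points and all variations
of the multipliers. -/
def IsExtremal (C : TotalSpace (EuclideanSpace ℝ (Fin m)) D × (Fin m → ℝ) → ℝ) (μ₀ T : ℝ)
    (γ : ℝ → TotalSpace (EuclideanSpace ℝ (Fin m)) D) (lam : ℝ → Fin n → ℝ) : Prop :=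
  ContinuousOn lam (Icc 0 T) ∧
    ∀ (δx : ℝ → EuclideanSpace ℝ (Fin n)) (δy : ℝ → Fin m → ℝ) (δlam : ℝ → Fin n → ℝ),
      ContDiff ℝ 1 δx → ContDiff ℝ 1 δy → Continuous δlam →
      δx 0 = 0 → δx T = 0 → δy 0 = 0 → δy T = 0 →
      HasDerivAt (fun ε : ℝ => S.extAction φ C μ₀ T
        (fun t => basePath φ γ t + ε • δx t) (fun t => S.coord (γ t) + ε • δy t)
        (fun t => lam t + ε • δlam t)) 0 0

/-- `γ` is a normal extremal with multipliers `lam`. -/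
def IsNormalExtremal (C : TotalSpace (EuclideanSpace ℝ (Fin m)) D × (Fin m → ℝ) → ℝ) (T : ℝ)
    (γ : ℝ → TotalSpace (EuclideanSpace ℝ (Fin m)) D) (lam : ℝ → Fin n → ℝ) : Prop :=
  S.IsExtremal φ C 1 T γ lam

/-- `γ` is an abnormal extremal with multipliers `lam`: these do not vanish identically, and the
cost does not enter the extended Lagrangian. -/
def IsAbnormalExtremal (C : TotalSpace (EuclideanSpace ℝ (Fin m)) D × (Fin m → ℝ) → ℝ) (T : ℝ)
    (γ : ℝ → TotalSpace (EuclideanSpace ℝ (Fin m)) D) (lam : ℝ → Fin n → ℝ) : Prop :=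
  S.IsExtremal φ C 0 T γ lam ∧ ∃ t ∈ Icc 0 T, lam t ≠ 0

/-- The necessary conditions, in the coordinates `(q^i, y^A)`:
`λ̇_i = ∂ℒ/∂q^i - λ_j (∂ρ_A^j/∂q^i) y^A`, `d/dt (∂ℒ/∂ẏ^A) = ∂ℒ/∂y^A - ρ_A^i λ_i` and
`q̇^i = ρ_A^i y^A` on `[0, T]`, including differentiability of the left-hand sides. -/
structure NecessaryConditions (C : TotalSpace (EuclideanSpace ℝ (Fin m)) D × (Fin m → ℝ) → ℝ)
    (T : ℝ) (γ : ℝ → TotalSpace (EuclideanSpace ℝ (Fin m)) D) (lam : ℝ → Fin n → ℝ) : Prop where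
  multiplier_eq : ∀ t ∈ Icc 0 T, ∀ i : Fin n,
    HasDerivWithinAt (fun s => lam s i)
      (fderiv ℝ (fun x => S.lagrangian φ C x (S.coord (γ t)) (S.ydot T γ t)) (basePath φ γ t)
          (EuclideanSpace.single i 1)
        - ∑ j, ∑ A, lam t j *
            fderiv ℝ (S.anchorCoeff φ A j) (basePath φ γ t) (EuclideanSpace.single i 1)
            * S.coord (γ t) A) (Icc 0 T) t
  fibre_eq : ∀ t ∈ Icc 0 T, ∀ A : Fin m,
    HasDerivWithinAt
      (fun s => fderiv ℝ (fun v => S.lagrangian φ C (basePath φ γ s) (S.coord (γ s)) v)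
        (S.ydot T γ s) (Pi.single A 1))
      (fderiv ℝ (fun y => S.lagrangian φ C (basePath φ γ t) y (S.ydot T γ t)) (S.coord (γ t))
          (Pi.single A 1)
        - ∑ i, S.anchorCoeff φ A i (basePath φ γ t) * lam t i) (Icc 0 T) t
  admissible_eq : ∀ t ∈ Icc 0 T, ∀ i : Fin n,
    HasDerivWithinAt (fun s => basePath φ γ s i)
      (∑ A, S.anchorCoeff φ A i (basePath φ γ t) * S.coord (γ t) A) (Icc 0 T) t

end Coordinates

end System

end NonholonomicControl

end

namespace NonholonomicControl

section Superposition

variable {K E F : Type*} [TopologicalSpace K]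
  [NormedAddCommGroup E] [NormedAddCommGroup F]

open Classical in
/-- The superposition operator `u ↦ f ∘ u` on continuous maps, with value `0` where `f ∘ u` is not
continuous. -/
noncomputable def superpose (f : E → F) (u : C(K, E)) : C(K, F) :=
  if h : Continuous (f ∘ u) then ⟨f ∘ u, h⟩ else 0

theorem superpose_apply {f : E → F} {u : C(K, E)} {Ω : Set E} (hf : ContinuousOn f Ω)
    (hu : ∀ t, u t ∈ Ω) (t : K) : superpose f u t = f (u t) := by
  have h : Continuous (f ∘ u) := hf.comp_continuous u.continuous hu
  simp [superpose, dif_pos h]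

variable [CompactSpace K]

theorem exists_forall_mem_of_dist_lt {Ω : Set E} (hΩ : IsOpen Ω) (u : C(K, E))
    (hu : ∀ t, u t ∈ Ω) : ∃ δ > 0, ∀ t a, dist a (u t) < δ → a ∈ Ω := by
  have hK : IsCompact (range u) := isCompact_range u.continuous
  obtain ⟨δ, hδ, h⟩ := hK.exists_thickening_subset_open hΩ (range_subset_iff.2 hu)
  exact ⟨δ, hδ, fun t a ha => h (Metric.mem_thickening_iff.2 ⟨u t, mem_range_self t, ha⟩)⟩

variable [NormedSpace ℝ E] [NormedSpace ℝ F]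

/-- Pointwise application of a continuous family of continuous linear maps. -/
noncomputable def pointwiseApply (A : C(K, E →L[ℝ] F)) : C(K, E) →L[ℝ] C(K, F) :=
  LinearMap.mkContinuous
    { toFun := fun u => ⟨fun t => A t (u t), A.continuous.clm_apply u.continuous⟩
      map_add' := fun u v => by ext t; simp
      map_smul' := fun c u => by ext t; simp } ‖A‖ fun u => by
    refine (ContinuousMap.norm_le _ (by positivity)).2 fun t => ?_
    exact ((A t).le_opNorm _).trans
      (mul_le_mul (A.norm_coe_le_norm t) (u.norm_coe_le_norm t) (norm_nonneg _)
        ((norm_nonneg (A t)).trans (A.norm_coe_le_norm t)))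

@[simp] theorem pointwiseApply_apply (A : C(K, E →L[ℝ] F)) (u : C(K, E)) (t : K) :
    pointwiseApply A u t = A t (u t) := rfl

theorem hasStrictFDerivAt_superpose {f : E → F} {Ω : Set E} (hΩ : IsOpen Ω)
    (hf : ContDiffOn ℝ 1 f Ω) (u : C(K, E)) (hu : ∀ t, u t ∈ Ω) (A : C(K, E →L[ℝ] F))
    (hA : ∀ t, A t = fderiv ℝ f (u t)) :
    HasStrictFDerivAt (superpose f) (pointwiseApply A) u := by
  have hK : IsCompact (range u) := isCompact_range u.continuous
  obtain ⟨δ₁, hδ₁, h₁⟩ := exists_forall_mem_of_dist_lt hΩ u hu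
  have hdiff : ∀ a ∈ Ω, DifferentiableAt ℝ f a := fun a ha =>
    (hf.differentiableOn one_ne_zero).differentiableAt (hΩ.mem_nhds ha)
  refine .of_isLittleO (Asymptotics.isLittleO_iff.2 fun c hc => ?_)
  have hunif := hK.uniformContinuousAt_of_continuousAt (fderiv ℝ f) (fun a ha => by
    obtain ⟨t, rfl⟩ := ha
    exact (hf.continuousOn_fderiv_of_isOpen hΩ le_rfl).continuousAt (hΩ.mem_nhds (hu t)))
    (Metric.dist_mem_uniformity hc)
  obtain ⟨δ₂, hδ₂, h₂⟩ := Metric.mem_uniformity_dist.1 hunif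
  have hδ : 0 < min δ₁ δ₂ := lt_min hδ₁ hδ₂
  rw [nhds_prod_eq]
  filter_upwards [Filter.prod_mem_prod (Metric.ball_mem_nhds u hδ) (Metric.ball_mem_nhds u hδ)]
  rintro ⟨v, w⟩ ⟨hv, hw⟩
  have hv' : ∀ t, v t ∈ Metric.ball (u t) (min δ₁ δ₂) := fun t =>
    (ContinuousMap.dist_apply_le_dist t).trans_lt hv
  have hw' : ∀ t, w t ∈ Metric.ball (u t) (min δ₁ δ₂) := fun t =>
    (ContinuousMap.dist_apply_le_dist t).trans_lt hw
  have hball : ∀ t, Metric.ball (u t) (min δ₁ δ₂) ⊆ Ω := fun t a ha =>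
    h₁ t a (lt_of_lt_of_le ha (min_le_left _ _))
  refine (ContinuousMap.norm_le _ (by positivity)).2 fun t => ?_
  have key := (convex_ball (u t) (min δ₁ δ₂)).norm_image_sub_le_of_norm_fderiv_le'
    (φ := fderiv ℝ f (u t)) (C := c)
    (fun a ha => hdiff a (hball t ha)) (fun a ha => by
      have := h₂ (a := u t) (b := a)
        (by rw [dist_comm]; exact lt_of_lt_of_le ha (min_le_right _ _)) (mem_range_self t)
      rw [mem_ofPred_eq, dist_comm, dist_eq_norm] at this
      exact this.le) (hw' t) (hv' t)
  have e₁ := superpose_apply hf.continuousOn (fun t => hball t (hv' t)) t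
  have e₂ := superpose_apply hf.continuousOn (fun t => hball t (hw' t)) t
  simp only [ContinuousMap.sub_apply, pointwiseApply_apply, e₁, e₂, hA]
  refine key.trans (mul_le_mul_of_nonneg_left ?_ hc.le)
  exact (v - w).norm_coe_le_norm t

end Superposition

section Primitive

variable {E : Type*} [NormedAddCommGroup E] {T : ℝ}

/-- Restriction of a function that is continuous on `[0, T]`. -/
def restrictIcc (T : ℝ) (f : ℝ → E) (hf : ContinuousOn f (Icc 0 T)) : C(Icc (0 : ℝ) T, E) :=
  ⟨fun t => f t, hf.domRestrict⟩

@[simp] theorem restrictIcc_apply (f : ℝ → E) (hf : ContinuousOn f (Icc 0 T)) (t : Icc (0 : ℝ) T) :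
    restrictIcc T f hf t = f t := rfl

theorem IccExtend_restrictIcc (hT : 0 ≤ T) (f : ℝ → E) (hf : ContinuousOn f (Icc 0 T)) {t : ℝ}
    (ht : t ∈ Icc 0 T) : IccExtend hT (restrictIcc T f hf) t = f t := by
  rw [IccExtend_of_mem _ _ ht]; rfl

variable [NormedSpace ℝ E]

/-- The primitive `t ↦ ∫₀ᵗ u` as a continuous linear operator on `C([0, T], E)`. -/
noncomputable def primitive (hT : 0 ≤ T) : C(Icc (0 : ℝ) T, E) →L[ℝ] C(Icc (0 : ℝ) T, E) :=
  LinearMap.mkContinuous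
    { toFun := fun u => ⟨fun t => ∫ s in (0 : ℝ)..t, IccExtend hT u s,
        (intervalIntegral.continuous_primitive (fun a b =>
          (u.continuous.Icc_extend' (h := hT)).intervalIntegrable a b) 0).comp
            continuous_subtype_val⟩
      map_add' := fun u v => by
        ext t
        exact intervalIntegral.integral_add (u.continuous.Icc_extend'.intervalIntegrable _ _)
          (v.continuous.Icc_extend'.intervalIntegrable _ _)
      map_smul' := fun c u => by
        ext t
        exact intervalIntegral.integral_smul c _ } T fun u => by
    refine (ContinuousMap.norm_le _ (by positivity)).2 fun t => ?_
    have := intervalIntegral.norm_integral_le_of_norm_le_const (a := 0) (b := (t : ℝ))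
      (f := IccExtend hT u) (C := ‖u‖) (fun s _ => u.norm_coe_le_norm _)
    refine this.trans ?_
    rw [sub_zero, abs_of_nonneg t.2.1, mul_comm]
    exact mul_le_mul_of_nonneg_right t.2.2 (norm_nonneg _)

theorem primitive_apply (hT : 0 ≤ T) (u : C(Icc (0 : ℝ) T, E)) (t : Icc (0 : ℝ) T) :
    primitive hT u t = ∫ s in (0 : ℝ)..t, IccExtend hT u s := rfl

theorem hasDerivWithinAt_integral_IccExtend [CompleteSpace E] (hT : 0 ≤ T)
    (u : C(Icc (0 : ℝ) T, E)) {t : ℝ} (ht : t ∈ Icc 0 T) :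
    HasDerivWithinAt (fun t => ∫ s in (0 : ℝ)..t, IccExtend hT u s) (u ⟨t, ht⟩) (Icc 0 T) t := by
  have := (u.continuous.Icc_extend' (h := hT)).integral_hasStrictDerivAt 0 t
  rw [IccExtend_of_mem _ _ ht] at this
  exact this.hasDerivAt.hasDerivWithinAt

/-- A function with continuous derivative on `[0, T]` is recovered from its derivative. -/
theorem integral_eq_sub_of_hasDerivWithinAt_Icc [CompleteSpace E] {f f' : ℝ → E}
    (hf : ∀ t ∈ Icc 0 T, HasDerivWithinAt f (f' t) (Icc 0 T) t) (hf' : ContinuousOn f' (Icc 0 T))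
    {t : ℝ} (ht : t ∈ Icc 0 T) : ∫ s in (0 : ℝ)..t, f' s = f t - f 0 := by
  have hsub : Icc 0 t ⊆ Icc 0 T := Icc_subset_Icc_right ht.2
  refine intervalIntegral.integral_eq_sub_of_hasDerivAt_of_le ht.1
    (fun s hs => ((hf s (hsub hs)).continuousWithinAt).mono hsub) (fun s hs => ?_)
    ((hf'.mono hsub).intervalIntegrable_of_Icc ht.1)
  exact (hf s (hsub ⟨hs.1.le, hs.2.le⟩)).hasDerivAt (Icc_mem_nhds hs.1 (hs.2.trans_le ht.2))

end Primitive

section LinearODE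

variable {E : Type*} [NormedAddCommGroup E] [NormedSpace ℝ E] [CompleteSpace E] {T : ℝ}

/-- A linear ordinary differential equation with continuous coefficients on `[0, T]` has a solution
on all of `[0, T]` for every initial value. -/
theorem exists_linear_ode_solution (hT : 0 ≤ T) {A : ℝ → E →L[ℝ] E} {f : ℝ → E}
    (hA : ContinuousOn A (Icc 0 T)) (hf : ContinuousOn f (Icc 0 T)) (x₀ : E) :
    ∃ x : ℝ → E, x 0 = x₀ ∧
      ∀ t ∈ Icc 0 T, HasDerivWithinAt x (A t (x t) + f t) (Icc 0 T) t := by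
  set Ac : C(Icc (0 : ℝ) T, E →L[ℝ] E) := restrictIcc T A hA
  set fc : C(Icc (0 : ℝ) T, E) := restrictIcc T f hf
  obtain ⟨M, hM, hAM⟩ : ∃ M : ℝ, 0 ≤ M ∧ ∀ t, ‖Ac t‖ ≤ M := by
    obtain ⟨M, hM⟩ := isCompact_Icc.exists_bound_of_continuousOn hA
    exact ⟨max M 0, le_max_right _ _, fun t => (hM t t.2).trans (le_max_left _ _)⟩
  have hL : 0 < M + 1 := by positivity
  let ex : C(Icc (0 : ℝ) T, ℝ) := ⟨fun t => Real.exp ((M + 1) * t), by fun_prop⟩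
  let g : C(Icc (0 : ℝ) T, E) → C(Icc (0 : ℝ) T, E) := fun z => ex • pointwiseApply Ac z + fc
  let Φ : C(Icc (0 : ℝ) T, E) → C(Icc (0 : ℝ) T, E) := fun z =>
    ⟨fun t => Real.exp (-((M + 1) * t)) • (x₀ + primitive hT (g z) t), by fun_prop⟩
  have hc : 0 ≤ M / (M + 1) := by positivity
  have hΦ : ContractingWith (M / (M + 1)).toNNReal Φ := by
    refine ⟨?_, LipschitzWith.of_dist_le_mul fun z w => ?_⟩
    · rw [Real.toNNReal_lt_one]
      exact (div_lt_one hL).2 (by linarith)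
    · rw [Real.coe_toNNReal _ hc]
      refine (ContinuousMap.dist_le (by positivity)).2 fun t => ?_
      have e₁ : Φ z t - Φ w t = Real.exp (-((M + 1) * t)) •
          ∫ s in (0 : ℝ)..t, IccExtend hT (ex • pointwiseApply Ac (z - w)) s := by
        have : primitive hT (g z) t - primitive hT (g w) t
            = primitive hT (ex • pointwiseApply Ac (z - w)) t := by
          have : g z - g w = ex • pointwiseApply Ac (z - w) := by
            ext s; simp [g, smul_sub]
          rw [← this, map_sub]; rfl
        rw [← primitive_apply, ← this]
        simp only [Φ, ContinuousMap.coe_mk, ← smul_sub, add_sub_add_left_eq_sub]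
      have hexp : ∫ s in (0 : ℝ)..t, Real.exp ((M + 1) * s)
          = (Real.exp ((M + 1) * t) - 1) / (M + 1) := by
        have hd : ∀ s : ℝ, HasDerivAt (fun s => Real.exp ((M + 1) * s) / (M + 1))
            (Real.exp ((M + 1) * s)) s := fun s => by
          have := (((hasDerivAt_id s).const_mul (M + 1)).exp).div_const (M + 1)
          simpa [hL.ne'] using this
        rw [intervalIntegral.integral_eq_sub_of_hasDerivAt (fun s _ => hd s)
          ((by fun_prop : Continuous fun s => Real.exp ((M + 1) * s)).intervalIntegrable _ _)]
        simp [sub_div]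
      have e₂ : ‖∫ s in (0 : ℝ)..t, IccExtend hT (ex • pointwiseApply Ac (z - w)) s‖
          ≤ ∫ s in (0 : ℝ)..t, Real.exp ((M + 1) * s) * (M * dist z w) := by
        refine intervalIntegral.norm_integral_le_of_norm_le t.2.1 (Filter.Eventually.of_forall
          fun s hs => ?_) ((by fun_prop : Continuous fun s : ℝ =>
            Real.exp ((M + 1) * s) * (M * dist z w)).intervalIntegrable _ _)
        have hs' : s ∈ Icc 0 T := ⟨hs.1.le, hs.2.trans t.2.2⟩
        rw [IccExtend_of_mem _ _ hs']
        simp only [ContinuousMap.smul_apply', pointwiseApply_apply, norm_smul, ex,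
          ContinuousMap.coe_mk, Real.norm_eq_abs, Real.abs_exp]
        refine mul_le_mul_of_nonneg_left ?_ (Real.exp_pos _).le
        refine ((Ac _).le_opNorm _).trans (mul_le_mul (hAM _) ?_
          (norm_nonneg _) hM)
        rw [dist_eq_norm]
        exact (z - w).norm_coe_le_norm _
      rw [intervalIntegral.integral_mul_const, hexp] at e₂
      rw [dist_eq_norm, e₁, norm_smul, Real.norm_eq_abs, Real.abs_exp]
      have e₃ := mul_le_mul_of_nonneg_left e₂ (Real.exp_pos (-((M + 1) * t))).le
      refine e₃.trans ?_
      have e₄ : Real.exp (-((M + 1) * t)) * (Real.exp ((M + 1) * t) - 1) ≤ 1 := by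
        rw [mul_sub, ← Real.exp_add]
        simp [(Real.exp_pos _).le]
      calc _ = (Real.exp (-((M + 1) * t)) * (Real.exp ((M + 1) * t) - 1))
            * (M / (M + 1) * dist z w) := by ring
        _ ≤ 1 * (M / (M + 1) * dist z w) := mul_le_mul_of_nonneg_right e₄ (by positivity)
        _ = _ := one_mul _
  obtain ⟨z, hz⟩ : ∃ z, Φ z = z := ⟨_, hΦ.fixedPoint_isFixedPt⟩
  have hx : ∀ t : Icc (0 : ℝ) T, ex t • z t = x₀ + primitive hT (g z) t := fun t => by
    conv_lhs => rw [← hz]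
    simp only [Φ, ex, ContinuousMap.coe_mk, smul_smul, ← Real.exp_add]
    simp
  refine ⟨fun t => x₀ + ∫ s in (0 : ℝ)..t, IccExtend hT (g z) s, by simp, fun t ht => ?_⟩
  have h := (hasDerivWithinAt_integral_IccExtend hT (g z) ht).const_add x₀
  convert h using 1
  have := hx ⟨t, ht⟩
  rw [primitive_apply] at this
  beta_reduce
  rw [show x₀ + ∫ s in (0 : ℝ)..t, IccExtend hT (g z) s = _ from this.symm]
  simp [g, Ac, fc]

/-- The terminal value version of `exists_linear_ode_solution`. -/
theorem exists_linear_ode_solution_terminal (hT : 0 ≤ T) {A : ℝ → E →L[ℝ] E} {f : ℝ → E}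
    (hA : ContinuousOn A (Icc 0 T)) (hf : ContinuousOn f (Icc 0 T)) (x₁ : E) :
    ∃ x : ℝ → E, x T = x₁ ∧
      ∀ t ∈ Icc 0 T, HasDerivWithinAt x (A t (x t) + f t) (Icc 0 T) t := by
  have hm : MapsTo (fun t => T - t) (Icc 0 T) (Icc 0 T) := fun t ht => by
    constructor <;> linarith [ht.1, ht.2]
  have hc : ContinuousOn (fun t : ℝ => T - t) (Icc 0 T) := by fun_prop
  obtain ⟨z, hz₀, hz⟩ := exists_linear_ode_solution hT (A := fun t => -A (T - t))
    (f := fun t => -f (T - t)) (hA.comp hc hm).neg (hf.comp hc hm).neg x₁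
  refine ⟨fun t => z (T - t), by simpa using hz₀, fun t ht => ?_⟩
  have h := (hz (T - t) (hm ht)).scomp t
    (((hasDerivAt_id t).const_sub T).hasDerivWithinAt (s := Icc 0 T)) hm
  refine HasDerivWithinAt.congr_deriv h ?_
  rw [neg_apply, sub_sub_cancel]
  module

end LinearODE

section FundamentalLemma

variable {T : ℝ}

theorem eqOn_zero_of_integral_sq_eq_zero (hT : 0 < T) {a : ℝ → ℝ}
    (ha : ContinuousOn a (Icc 0 T)) (h : ∫ t in (0 : ℝ)..T, a t * a t = 0) :
    ∀ t ∈ Icc 0 T, a t = 0 := by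
  intro t ht
  by_contra hne
  have := intervalIntegral.integral_pos hT (ha.mul ha) (fun s _ => mul_self_nonneg _)
    ⟨t, ht, mul_self_pos.2 hne⟩
  exact absurd h (ne_of_gt this)

/-- The fundamental lemma of the calculus of variations for continuous variations. -/
theorem eqOn_zero_of_forall_integral_mul_eq_zero (hT : 0 < T) {a : ℝ → ℝ}
    (ha : ContinuousOn a (Icc 0 T))
    (h : ∀ η : ℝ → ℝ, Continuous η → ∫ t in (0 : ℝ)..T, a t * η t = 0) :
    ∀ t ∈ Icc 0 T, a t = 0 := by
  refine eqOn_zero_of_integral_sq_eq_zero hT ha ?_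
  have hc : Continuous (IccExtend hT.le (restrictIcc T a ha)) :=
    (restrictIcc T a ha).continuous.Icc_extend'
  refine Eq.trans (intervalIntegral.integral_congr fun t ht => ?_) (h _ hc)
  rw [uIcc_of_le hT.le] at ht
  simp only [IccExtend_restrictIcc hT.le a ha ht]

theorem integral_mul_deriv_add_deriv_mul_eq (hT : 0 ≤ T) {a a' b b' : ℝ → ℝ}
    (ha : ∀ t ∈ Icc 0 T, HasDerivWithinAt a (a' t) (Icc 0 T) t) (ha' : ContinuousOn a' (Icc 0 T))
    (hb : ∀ t ∈ Icc 0 T, HasDerivWithinAt b (b' t) (Icc 0 T) t)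
    (hb' : ContinuousOn b' (Icc 0 T)) :
    ∫ t in (0 : ℝ)..T, (a' t * b t + a t * b' t) = a T * b T - a 0 * b 0 := by
  have hac : ContinuousOn a (Icc 0 T) := fun t ht => (ha t ht).continuousWithinAt
  have hbc : ContinuousOn b (Icc 0 T) := fun t ht => (hb t ht).continuousWithinAt
  exact integral_eq_sub_of_hasDerivWithinAt_Icc (f := fun t => a t * b t)
    (fun t ht => (ha t ht).mul (hb t ht)) ((ha'.mul hbc).add (hac.mul hb')) (right_mem_Icc.2 hT)

/-- The lemma of du Bois-Reymond. -/
theorem hasDerivWithinAt_of_forall_integral_eq_zero (hT : 0 < T) {a b : ℝ → ℝ}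
    (ha : ContinuousOn a (Icc 0 T)) (hb : ContinuousOn b (Icc 0 T))
    (h : ∀ η : ℝ → ℝ, ContDiff ℝ 1 η → η 0 = 0 → η T = 0 →
      ∫ t in (0 : ℝ)..T, (a t * η t + b t * deriv η t) = 0) :
    ∀ t ∈ Icc 0 T, HasDerivWithinAt b (a t) (Icc 0 T) t := by
  set α : ℝ → ℝ := fun t => ∫ s in (0 : ℝ)..t, IccExtend hT.le (restrictIcc T a ha) s
  have hα : ∀ t ∈ Icc 0 T, HasDerivWithinAt α (a t) (Icc 0 T) t := fun t ht =>
    hasDerivWithinAt_integral_IccExtend hT.le (restrictIcc T a ha) ht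
  have hαc : ContinuousOn α (Icc 0 T) := fun t ht => (hα t ht).continuousWithinAt
  set c : ℝ := (∫ t in (0 : ℝ)..T, (b t - α t)) / T
  set d : ℝ → ℝ := fun t => b t - α t - c
  have hd : ContinuousOn d (Icc 0 T) := (hb.sub hαc).sub continuousOn_const
  have hdi : ∫ t in (0 : ℝ)..T, d t = 0 := by
    have h0 : IntervalIntegrable (fun t => b t - α t) volume 0 T :=
      (hb.sub hαc).intervalIntegrable_of_Icc hT.le
    simp only [d]
    rw [intervalIntegral.integral_sub h0 intervalIntegrable_const]
    simp only [intervalIntegral.integral_const, c, sub_zero, smul_eq_mul]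
    field_simp
    simp
  set e : ℝ → ℝ := IccExtend hT.le (restrictIcc T d hd)
  have he : Continuous e := (restrictIcc T d hd).continuous.Icc_extend'
  have hed : ∀ t ∈ Icc 0 T, e t = d t := fun t ht => IccExtend_restrictIcc hT.le d hd ht
  set η : ℝ → ℝ := fun t => ∫ s in (0 : ℝ)..t, e s
  have hη : ∀ t, HasDerivAt η (e t) t := fun t => (he.integral_hasStrictDerivAt 0 t).hasDerivAt
  have hηd : deriv η = e := funext fun t => (hη t).deriv
  have hη0 : η 0 = 0 := by simp [η]
  have hηT : η T = 0 := by
    rw [← hdi]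
    exact intervalIntegral.integral_congr fun t ht => hed t (by rwa [uIcc_of_le hT.le] at ht)
  have hη1 : ContDiff ℝ 1 η := contDiff_one_iff_deriv.2
    ⟨fun t => (hη t).differentiableAt, hηd ▸ he⟩
  have h1 := h η hη1 hη0 hηT
  have h2 := integral_mul_deriv_add_deriv_mul_eq hT.le hα ha
    (fun t _ => (hη t).hasDerivWithinAt) he.continuousOn
  rw [hη0, hηT] at h2
  have hηc : Continuous η := hη1.continuous
  have h3 : ∫ t in (0 : ℝ)..T, (b t - α t) * e t = 0 := by
    have : ∫ t in (0 : ℝ)..T, ((a t * η t + b t * deriv η t) - (a t * η t + α t * e t)) = 0 := by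
      rw [intervalIntegral.integral_sub _ _, h1, h2]
      · simp
      · rw [hηd]
        exact ((ha.mul hηc.continuousOn).add (hb.mul he.continuousOn)).intervalIntegrable_of_Icc
          hT.le
      · exact ((ha.mul hηc.continuousOn).add (hαc.mul he.continuousOn)).intervalIntegrable_of_Icc
          hT.le
    refine Eq.trans (intervalIntegral.integral_congr fun t _ => ?_) this
    simp only [hηd]; ring
  have h4 : ∫ t in (0 : ℝ)..T, d t * d t = 0 := by
    have : ∫ t in (0 : ℝ)..T, ((b t - α t) * e t - c * e t) = 0 := by
      have i₁ : IntervalIntegrable (fun t => (b t - α t) * e t) volume 0 T :=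
        ((hb.sub hαc).mul he.continuousOn).intervalIntegrable_of_Icc hT.le
      have i₂ : IntervalIntegrable (fun t => c * e t) volume 0 T :=
        (continuous_const.mul he).intervalIntegrable _ _
      rw [intervalIntegral.integral_sub i₁ i₂, h3,
        intervalIntegral.integral_const_mul]
      change 0 - c * η T = 0
      rw [hηT]; simp
    refine Eq.trans (intervalIntegral.integral_congr fun t ht => ?_) this
    rw [uIcc_of_le hT.le] at ht
    simp only [hed t ht, d]; ring
  have h5 := eqOn_zero_of_integral_sq_eq_zero hT hd h4
  intro t ht
  refine ((hα t ht).add_const c).congr (fun s hs => ?_) ?_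
  · have := h5 s hs; simp only [d] at this; linarith
  · have := h5 t ht; simp only [d] at this; linarith

end FundamentalLemma

end NonholonomicControl

namespace NonholonomicControl

section FirstVariation

variable {Z : Type*} [NormedAddCommGroup Z] [NormedSpace ℝ Z] {T : ℝ}

/-- Differentiation of an integral functional along a line of curves. -/
theorem hasDerivAt_integral_comp_add_smul (hT : 0 ≤ T) {M : Z → ℝ} {O : Set Z} (hO : IsOpen O)
    (hM : ContDiffOn ℝ 1 M O) {c δ : ℝ → Z} (hc : ContinuousOn c (Icc 0 T))
    (hδ : ContinuousOn δ (Icc 0 T)) (hcO : ∀ t ∈ Icc 0 T, c t ∈ O) :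
    HasDerivAt (fun ε : ℝ => ∫ t in (0 : ℝ)..T, M (c t + ε • δ t))
      (∫ t in (0 : ℝ)..T, fderiv ℝ M (c t) (δ t)) 0 := by
  set c' := restrictIcc T c hc
  set δ' := restrictIcc T δ hδ
  have hdM : ContinuousOn (fun t => fderiv ℝ M (c t)) (Icc 0 T) :=
    (hM.continuousOn_fderiv_of_isOpen hO le_rfl).comp hc hcO
  set A := restrictIcc T _ hdM
  have hcO' : ∀ t, c' t ∈ O := fun t => hcO t t.2
  have hT' : T ∈ Icc (0 : ℝ) T := right_mem_Icc.2 hT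
  have h₁ : HasStrictFDerivAt (superpose M) (pointwiseApply A) c' :=
    hasStrictFDerivAt_superpose hO hM c' hcO' A fun t => rfl
  have hline : HasDerivAt (fun ε : ℝ => c' + ε • δ') δ' 0 := by
    simpa using ((hasDerivAt_id (0 : ℝ)).smul_const δ').const_add c'
  have h₂ : HasDerivAt (fun ε : ℝ => superpose M (c' + ε • δ')) (pointwiseApply A δ') 0 :=
    HasFDerivAt.comp_hasDerivAt (l := superpose M) 0 (by simpa using h₁.hasFDerivAt) hline
  have h₃ := ((ContinuousMap.evalCLM ℝ (⟨T, hT'⟩ : Icc (0 : ℝ) T)).comp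
    (primitive (E := ℝ) hT)).hasFDerivAt.comp_hasDerivAt (0 : ℝ) h₂
  have e : ∫ t in (0 : ℝ)..T, fderiv ℝ M (c t) (δ t)
      = ((ContinuousMap.evalCLM ℝ (⟨T, hT'⟩ : Icc (0 : ℝ) T)).comp
        (primitive (E := ℝ) hT)) (pointwiseApply A δ') := by
    refine intervalIntegral.integral_congr fun t ht => ?_
    rw [uIcc_of_le hT] at ht
    rw [IccExtend_of_mem _ _ ht]
    rfl
  rw [e]
  refine h₃.congr_of_eventuallyEq ?_
  obtain ⟨r, hr, hrO⟩ := exists_forall_mem_of_dist_lt hO c' hcO'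
  have hcont : Filter.Tendsto (fun ε : ℝ => c' + ε • δ') (𝓝 0) (𝓝 c') := by
    simpa using hline.continuousAt.tendsto
  filter_upwards [hcont (Metric.ball_mem_nhds c' hr)] with ε hε
  refine intervalIntegral.integral_congr fun t ht => ?_
  rw [uIcc_of_le hT] at ht
  rw [IccExtend_of_mem _ _ ht, superpose_apply hM.continuousOn fun s =>
    hrO s _ ((ContinuousMap.dist_apply_le_dist s).trans_lt hε)]
  rfl

end FirstVariation

section Stationary

variable {X Y P : Type*} [NormedAddCommGroup X] [NormedSpace ℝ X] [NormedAddCommGroup Y]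
  [NormedSpace ℝ Y] [NormedAddCommGroup P] [NormedSpace ℝ P] {T : ℝ}

theorem hasDerivWithinAt_clm_of_basis [FiniteDimensional ℝ X] {ι : Type*} [Fintype ι]
    (b : Module.Basis ι ℝ X) {ℓ : ℝ → X →L[ℝ] ℝ} {ℓ' : X →L[ℝ] ℝ} {s : Set ℝ} {t : ℝ}
    (h : ∀ i, HasDerivWithinAt (fun t => ℓ t (b i)) (ℓ' (b i)) s t) :
    HasDerivWithinAt ℓ ℓ' s t := by
  have key : ∀ f : X →L[ℝ] ℝ, f = ∑ i, f (b i) • LinearMap.toContinuousLinearMap (b.coord i) := by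
    intro f
    ext v
    conv_lhs => rw [← b.sum_repr v, map_sum]
    simp [mul_comm]
  have : ℓ = fun t => ∑ i, ℓ t (b i) • LinearMap.toContinuousLinearMap (b.coord i) :=
    funext fun t => key (ℓ t)
  rw [this, key ℓ']
  exact HasDerivWithinAt.fun_sum fun i _ =>
    HasDerivWithinAt.smul_const (h i) (LinearMap.toContinuousLinearMap (b.coord i))

/-- The Euler-Lagrange equations of a linearized Lagrange problem: `aL` is the derivative of the
Lagrangian, `aR` that of the constraint, `lam` the multiplier. -/
structure EulerLagrange (T : ℝ) (aL : ℝ → X × Y × Y →L[ℝ] ℝ) (aR : ℝ → X × Y →L[ℝ] X)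
    (lam : ℝ → X →L[ℝ] ℝ) : Prop where
  base : ∀ t ∈ Icc 0 T, ∀ e : X,
    HasDerivWithinAt (fun s => lam s e) (aL t (e, 0, 0) - lam t (aR t (e, 0))) (Icc 0 T) t
  fibre : ∀ t ∈ Icc 0 T, ∀ e : Y,
    HasDerivWithinAt (fun s => aL s (0, 0, e)) (aL t (0, e, 0) - lam t (aR t (0, e))) (Icc 0 T) t

theorem eulerLagrange_iff_integral_eq_zero [FiniteDimensional ℝ X] [FiniteDimensional ℝ Y]
    (hT : 0 < T) {aL : ℝ → X × Y × Y →L[ℝ] ℝ} {aR : ℝ → X × Y →L[ℝ] X} {lam : ℝ → X →L[ℝ] ℝ}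
    {r : ℝ → X} {B : P →L[ℝ] X →L[ℝ] ℝ} (hB : ∀ a, (∀ p, B p a = 0) → a = 0)
    (haL : ContinuousOn aL (Icc 0 T)) (haR : ContinuousOn aR (Icc 0 T))
    (hlam : ContinuousOn lam (Icc 0 T)) (hr : ContinuousOn r (Icc 0 T)) :
    (∀ (δx : ℝ → X) (δy : ℝ → Y) (δp : ℝ → P), ContDiff ℝ 1 δx → ContDiff ℝ 1 δy →
      Continuous δp → δx 0 = 0 → δx T = 0 → δy 0 = 0 → δy T = 0 →
      ∫ t in (0 : ℝ)..T, (aL t (δx t, δy t, deriv δy t) + B (δp t) (r t)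
        + lam t (deriv δx t - aR t (δx t, δy t))) = 0) ↔
    (∀ t ∈ Icc 0 T, r t = 0) ∧ EulerLagrange T aL aR lam := by
  constructor
  · intro h
    refine ⟨fun t ht => hB _ fun p => ?_, ⟨fun t ht e => ?_, fun t ht e => ?_⟩⟩
    · refine eqOn_zero_of_forall_integral_mul_eq_zero hT (a := fun t => B p (r t))
        ((B p).continuous.comp_continuousOn hr) (fun η hη => ?_) t ht
      have := h 0 0 (fun t => η t • p) contDiff_const contDiff_const (by fun_prop) rfl rfl rfl rfl
      refine Eq.trans (intervalIntegral.integral_congr fun s _ => ?_) this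
      simp [mul_comm, Prod.mk_zero_zero]
    · refine hasDerivWithinAt_of_forall_integral_eq_zero hT
        (a := fun t => aL t (e, 0, 0) - lam t (aR t (e, 0))) ?_
        (hlam.clm_apply continuousOn_const) (fun η hη h0 hT' => ?_) t ht
      · exact (haL.clm_apply continuousOn_const).sub
          (hlam.clm_apply (haR.clm_apply continuousOn_const))
      · have := h (fun t => η t • e) 0 0 (hη.smul contDiff_const) contDiff_const continuous_const
          (by simp [h0]) (by simp [hT']) rfl rfl
        refine Eq.trans (intervalIntegral.integral_congr fun s _ => ?_) this
        have hd : deriv (fun t => η t • e) s = deriv η s • e :=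
          deriv_smul_const (hη.differentiable one_ne_zero s) e
        have e₁ : ((η s • e, (0 : ℝ → Y) s, deriv (0 : ℝ → Y) s) : X × Y × Y)
            = η s • (e, 0, 0) := by simp
        have e₂ : ((η s • e, (0 : ℝ → Y) s) : X × Y) = η s • (e, 0) := by simp
        rw [hd, e₁, e₂]
        simp only [map_smul, map_sub, smul_eq_mul, Pi.zero_apply, map_zero, zero_apply]
        ring
    · refine hasDerivWithinAt_of_forall_integral_eq_zero hT
        (a := fun t => aL t (0, e, 0) - lam t (aR t (0, e))) ?_
        (haL.clm_apply continuousOn_const) (fun η hη h0 hT' => ?_) t ht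
      · exact (haL.clm_apply continuousOn_const).sub
          (hlam.clm_apply (haR.clm_apply continuousOn_const))
      · have := h 0 (fun t => η t • e) 0 contDiff_const (hη.smul contDiff_const) continuous_const
          rfl rfl (by simp [h0]) (by simp [hT'])
        refine Eq.trans (intervalIntegral.integral_congr fun s _ => ?_) this
        have hd : deriv (fun t => η t • e) s = deriv η s • e :=
          deriv_smul_const (hη.differentiable one_ne_zero s) e
        have e₁ : (((0 : ℝ → X) s, η s • e, deriv η s • e) : X × Y × Y)
            = η s • (0, e, 0) + deriv η s • (0, 0, e) := by simp
        have e₂ : (((0 : ℝ → X) s, η s • e) : X × Y) = η s • (0, e) := by simp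
        have e₃ : deriv (0 : ℝ → X) s = 0 := by simp
        rw [hd, e₁, e₂, e₃]
        simp only [map_smul, map_sub, map_add, smul_eq_mul, Pi.zero_apply, map_zero, zero_apply]
        ring
  · rintro ⟨hr0, hEL⟩ δx δy δp hδx hδy hδp hx0 hxT hy0 hyT
    have h₁ : ∀ t ∈ Icc 0 T, HasDerivWithinAt lam
        ((aL t).comp (.inl ℝ X (Y × Y)) - (lam t).comp ((aR t).comp (.inl ℝ X Y))) (Icc 0 T) t :=
      fun t ht => hasDerivWithinAt_clm_of_basis (Module.finBasis ℝ _) fun _ => hEL.base t ht _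
    have h₂ : ∀ t ∈ Icc 0 T, HasDerivWithinAt
        (fun s => (aL s).comp ((ContinuousLinearMap.inr ℝ X (Y × Y)).comp (.inr ℝ Y Y)))
        ((aL t).comp ((ContinuousLinearMap.inr ℝ X (Y × Y)).comp (.inl ℝ Y Y))
          - (lam t).comp ((aR t).comp (.inr ℝ X Y))) (Icc 0 T) t :=
      fun t ht => hasDerivWithinAt_clm_of_basis (Module.finBasis ℝ _) fun _ => hEL.fibre t ht _
    have hdx : ∀ t, HasDerivAt δx (deriv δx t) t := fun t =>
      (hδx.differentiable one_ne_zero t).hasDerivAt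
    have hdy : ∀ t, HasDerivAt δy (deriv δy t) t := fun t =>
      (hδy.differentiable one_ne_zero t).hasDerivAt
    have hcx : Continuous (deriv δx) := hδx.continuous_deriv le_rfl
    have hcy : Continuous (deriv δy) := hδy.continuous_deriv le_rfl
    have key := integral_eq_sub_of_hasDerivWithinAt_Icc (T := T) (t := T)
      (f := fun t => lam t (δx t) + aL t (0, 0, δy t))
      (f' := fun t => aL t (δx t, δy t, deriv δy t) + B (δp t) (r t)
        + lam t (deriv δx t - aR t (δx t, δy t))) (fun t ht => ?_) ?_ (right_mem_Icc.2 hT.le)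
    · rw [key]
      simp [hx0, hxT, hy0, hyT, Prod.mk_zero_zero]
    · refine (((h₁ t ht).clm_apply (hdx t).hasDerivWithinAt).add
        ((h₂ t ht).clm_apply (hdy t).hasDerivWithinAt)).congr_deriv ?_
      have e₁ : ((δx t, δy t, deriv δy t) : X × Y × Y)
          = (δx t, 0, 0) + (0, δy t, 0) + (0, 0, deriv δy t) := by simp
      have e₂ : ((δx t, δy t) : X × Y) = (δx t, 0) + (0, δy t) := by simp
      rw [e₁, e₂, hr0 t ht]
      simp only [map_add, map_sub, map_zero, sub_apply, ContinuousLinearMap.comp_apply,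
        ContinuousLinearMap.inl_apply, ContinuousLinearMap.inr_apply]
      rw [← Prod.mk_zero_zero]
      ring
    · refine ((haL.clm_apply ?_).add ((B.continuous.comp hδp).continuousOn.clm_apply hr)).add
        (hlam.clm_apply (hcx.continuousOn.sub (haR.clm_apply ?_)))
      · exact (hδx.continuous.prodMk (hδy.continuous.prodMk hcy)).continuousOn
      · exact (hδx.continuous.prodMk hδy.continuous).continuousOn

theorem fderiv_extended {L : X × Y × Y → ℝ} {R : X × Y → X} {B : P →L[ℝ] X →L[ℝ] ℝ} (μ : ℝ)
    {x w : X} {y v : Y} {p : P} (hL : DifferentiableAt ℝ L (x, y, v))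
    (hR : DifferentiableAt ℝ R (x, y)) (δ : X × Y × X × Y × P) :
    fderiv ℝ (fun z : X × Y × X × Y × P => μ * L (z.1, z.2.1, z.2.2.2.1)
        + B z.2.2.2.2 (z.2.2.1 - R (z.1, z.2.1))) (x, y, w, v, p) δ
      = μ * fderiv ℝ L (x, y, v) (δ.1, δ.2.1, δ.2.2.2.1) + B δ.2.2.2.2 (w - R (x, y))
        + B p (δ.2.2.1 - fderiv ℝ R (x, y) (δ.1, δ.2.1)) := by
  let c : X × Y × X × Y × P := (x, y, w, v, p)
  have hx : HasFDerivAt (fun z : X × Y × X × Y × P => z.1) (.fst ℝ X _) c := hasFDerivAt_fst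
  have h₁ : HasFDerivAt (fun z : X × Y × X × Y × P => z.2) (.snd ℝ X _) c := hasFDerivAt_snd
  have hy := h₁.fst
  have h₂ := h₁.snd
  have hw := h₂.fst
  have h₃ := h₂.snd
  have hv := h₃.fst
  have hp := h₃.snd
  have hL' := (hL.hasFDerivAt.comp c (hx.prodMk (hy.prodMk hv))).const_mul μ
  have hR' := hR.hasFDerivAt.comp c (hx.prodMk hy)
  have hB' := (B.hasFDerivAt.comp c hp).clm_apply (hw.sub hR')
  have := (hL'.add hB').fderiv
  refine (DFunLike.congr_fun this δ).trans ?_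
  simp [c]
  ring

theorem contDiffOn_extended {L : X × Y × Y → ℝ} {R : X × Y → X} (B : P →L[ℝ] X →L[ℝ] ℝ) (μ : ℝ)
    {Ω : Set (X × Y × Y)} {Θ : Set (X × Y)} (hL : ContDiffOn ℝ 1 L Ω) (hR : ContDiffOn ℝ 1 R Θ) :
    ContDiffOn ℝ 1 (fun z : X × Y × X × Y × P => μ * L (z.1, z.2.1, z.2.2.2.1)
        + B z.2.2.2.2 (z.2.2.1 - R (z.1, z.2.1)))
      {z | (z.1, z.2.1, z.2.2.2.1) ∈ Ω ∧ (z.1, z.2.1) ∈ Θ} := by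
  have h₁ : ContDiffOn ℝ 1 (fun z : X × Y × X × Y × P => L (z.1, z.2.1, z.2.2.2.1))
      {z | (z.1, z.2.1, z.2.2.2.1) ∈ Ω ∧ (z.1, z.2.1) ∈ Θ} :=
    hL.comp (g := L) (by fun_prop) fun z hz => hz.1
  have h₂ : ContDiffOn ℝ 1 (fun z : X × Y × X × Y × P => R (z.1, z.2.1))
      {z | (z.1, z.2.1, z.2.2.2.1) ∈ Ω ∧ (z.1, z.2.1) ∈ Θ} :=
    hR.comp (g := R) (by fun_prop) fun z hz => hz.2
  have h₃ : ContDiff ℝ 1 (fun z : X × Y × X × Y × P => B z.2.2.2.2) := by fun_prop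
  have h₄ : ContDiff ℝ 1 (fun z : X × Y × X × Y × P => z.2.2.1) := by fun_prop
  exact (contDiffOn_const.mul h₁).add (h₃.contDiffOn.clm_apply (h₄.contDiffOn.sub h₂))

end Stationary

end NonholonomicControl

namespace NonholonomicControl

section Multipliers

variable {X Y : Type*} [NormedAddCommGroup X] [NormedSpace ℝ X] [NormedAddCommGroup Y]
  [NormedSpace ℝ Y] {T : ℝ}

/-- The curve `(∫ w, ∫ v, v)` in `X × Y × Y` as a continuous linear function of the velocities. -/
noncomputable def velocityLift (X Y : Type*) [NormedAddCommGroup X] [NormedSpace ℝ X]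
    [NormedAddCommGroup Y] [NormedSpace ℝ Y] {T : ℝ} (hT : 0 ≤ T) :
    C(Icc (0 : ℝ) T, X) × C(Icc (0 : ℝ) T, Y) →L[ℝ] C(Icc (0 : ℝ) T, X × Y × Y) :=
  ((ContinuousLinearMap.inl ℝ X (Y × Y)).compLeftContinuous ℝ _).comp
      ((primitive hT).comp (.fst ℝ _ _))
    + (((ContinuousLinearMap.inr ℝ X (Y × Y)).comp (.inl ℝ Y Y)).compLeftContinuous ℝ _).comp
      ((primitive hT).comp (.snd ℝ _ _))
    + (((ContinuousLinearMap.inr ℝ X (Y × Y)).comp (.inr ℝ Y Y)).compLeftContinuous ℝ _).comp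
      (.snd ℝ _ _)

theorem velocityLift_apply (hT : 0 ≤ T) (w : C(Icc (0 : ℝ) T, X)) (v : C(Icc (0 : ℝ) T, Y))
    (t : Icc (0 : ℝ) T) :
    velocityLift X Y hT (w, v) t = (primitive hT w t, primitive hT v t, v t) := by
  simp [velocityLift]

/-- Projection of curves in `X × Y × Y` to curves in `X × Y`. -/
noncomputable def forgetVelocity (X Y : Type*) [NormedAddCommGroup X] [NormedSpace ℝ X]
    [NormedAddCommGroup Y] [NormedSpace ℝ Y] (T : ℝ) :
    C(Icc (0 : ℝ) T, X × Y × Y) →L[ℝ] C(Icc (0 : ℝ) T, X × Y) :=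
  ((ContinuousLinearMap.fst ℝ X (Y × Y)).prod
    ((ContinuousLinearMap.fst ℝ Y Y).comp (.snd ℝ X (Y × Y)))).compLeftContinuous ℝ _

theorem forgetVelocity_apply (z : C(Icc (0 : ℝ) T, X × Y × Y)) (t : Icc (0 : ℝ) T) :
    forgetVelocity X Y T z t = ((z t).1, (z t).2.1) := rfl

theorem primitive_restrictIcc [CompleteSpace X] (hT : 0 ≤ T) {f f' : ℝ → X}
    (hf : ∀ t ∈ Icc 0 T, HasDerivWithinAt f (f' t) (Icc 0 T) t) (hf' : ContinuousOn f' (Icc 0 T))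
    (t : Icc (0 : ℝ) T) : primitive hT (restrictIcc T f' hf') t = f t - f 0 := by
  rw [← integral_eq_sub_of_hasDerivWithinAt_Icc hf hf' t.2, primitive_apply]
  refine intervalIntegral.integral_congr fun s hs => ?_
  rw [uIcc_of_le t.2.1] at hs
  exact IccExtend_restrictIcc hT f' hf' ⟨hs.1, hs.2.trans t.2.2⟩

theorem integral_IccExtend_eq (hT : 0 ≤ T) {u : C(Icc (0 : ℝ) T, X)} {f : ℝ → X}
    (h : ∀ t, u t = f t) : ∫ s in (0 : ℝ)..T, IccExtend hT u s = ∫ s in (0 : ℝ)..T, f s := by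
  refine intervalIntegral.integral_congr fun s hs => ?_
  rw [uIcc_of_le hT] at hs
  rw [IccExtend_of_mem _ _ hs, h]

/-- Lagrange multiplier rule in function space: for a weak local minimizer of `∫ L(x, y, ẏ)` among
the curves with `ẋ = R(x, y)` and fixed end points. -/
theorem exists_functional_of_weakLocalMin [CompleteSpace X] [CompleteSpace Y] (hT : 0 ≤ T)
    {L : X × Y × Y → ℝ} {R : X × Y → X} {Ω : Set (X × Y × Y)} {Θ : Set (X × Y)}
    (hΩ : IsOpen Ω) (hΘ : IsOpen Θ) (hL : ContDiffOn ℝ 1 L Ω) (hR : ContDiffOn ℝ 1 R Θ)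
    {x : ℝ → X} {y v : ℝ → Y} (hv : ContinuousOn v (Icc 0 T))
    (hx : ∀ t ∈ Icc 0 T, HasDerivWithinAt x (R (x t, y t)) (Icc 0 T) t)
    (hy : ∀ t ∈ Icc 0 T, HasDerivWithinAt y (v t) (Icc 0 T) t)
    (hzΩ : ∀ t ∈ Icc 0 T, (x t, y t, v t) ∈ Ω) (hzΘ : ∀ t ∈ Icc 0 T, (x t, y t) ∈ Θ)
    {δ : ℝ} (hδ : 0 < δ)
    (hmin : ∀ (x' : ℝ → X) (y' v' : ℝ → Y), ContinuousOn v' (Icc 0 T) →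
      (∀ t ∈ Icc 0 T, HasDerivWithinAt x' (R (x' t, y' t)) (Icc 0 T) t) →
      (∀ t ∈ Icc 0 T, HasDerivWithinAt y' (v' t) (Icc 0 T) t) →
      x' 0 = x 0 → y' 0 = y 0 → x' T = x T → y' T = y T →
      (∀ t ∈ Icc 0 T, dist (x' t, y' t, v' t) (x t, y t, v t) < δ) →
      ∫ t in (0 : ℝ)..T, L (x t, y t, v t) ≤ ∫ t in (0 : ℝ)..T, L (x' t, y' t, v' t)) :
    ∃ (Λ : Module.Dual ℝ (C(Icc (0 : ℝ) T, X) × X × Y)) (μ : ℝ), (Λ, μ) ≠ 0 ∧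
      ∀ (w' : C(Icc (0 : ℝ) T, X)) (v' : C(Icc (0 : ℝ) T, Y)) (f : C(Icc (0 : ℝ) T, X)),
        (∀ t, f t = w' t - fderiv ℝ R (x t, y t) (primitive hT w' t, primitive hT v' t)) →
        Λ (f, primitive hT w' ⟨T, right_mem_Icc.2 hT⟩, primitive hT v' ⟨T, right_mem_Icc.2 hT⟩)
          + μ * ∫ t in (0 : ℝ)..T, IccExtend hT (fun t : Icc (0 : ℝ) T =>
            fderiv ℝ L (x t, y t, v t) (primitive hT w' t, primitive hT v' t, v' t)) t = 0 := by
  have hxc : ContinuousOn x (Icc 0 T) := fun t ht => (hx t ht).continuousWithinAt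
  have hyc : ContinuousOn y (Icc 0 T) := fun t ht => (hy t ht).continuousWithinAt
  have hzc : ContinuousOn (fun t => (x t, y t, v t)) (Icc 0 T) := hxc.prodMk (hyc.prodMk hv)
  have hqc : ContinuousOn (fun t => (x t, y t)) (Icc 0 T) := hxc.prodMk hyc
  have hwc : ContinuousOn (fun t => R (x t, y t)) (Icc 0 T) := hR.continuousOn.comp hqc hzΘ
  set τ : Icc (0 : ℝ) T := ⟨T, right_mem_Icc.2 hT⟩
  set w₀ := restrictIcc T _ hwc
  set v₀ := restrictIcc T v hv
  set aL := restrictIcc T (fun t => fderiv ℝ L (x t, y t, v t))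
    ((hL.continuousOn_fderiv_of_isOpen hΩ le_rfl).comp hzc hzΩ)
  set aR := restrictIcc T (fun t => fderiv ℝ R (x t, y t))
    ((hR.continuousOn_fderiv_of_isOpen hΘ le_rfl).comp hqc hzΘ)
  set Zl := velocityLift X Y hT
  set z₀ : C(Icc (0 : ℝ) T, X × Y × Y) := ContinuousMap.const _ (x 0, y 0, 0)
  set z : C(Icc (0 : ℝ) T, X) × C(Icc (0 : ℝ) T, Y) → C(Icc (0 : ℝ) T, X × Y × Y) :=
    fun p => z₀ + Zl p
  have hz : ∀ p t, z p t = (x 0 + primitive hT p.1 t, y 0 + primitive hT p.2 t, p.2 t) :=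
    fun p t => by
      have := velocityLift_apply hT p.1 p.2 t
      simp only [z, z₀, Zl, ContinuousMap.add_apply, this, ContinuousMap.const_apply,
        Prod.mk_add_mk, zero_add]
  have hz' : ∀ t, z (w₀, v₀) t = (x t, y t, v t) := fun t => by
    rw [hz]
    simp only [w₀, v₀, primitive_restrictIcc hT hx hwc t, primitive_restrictIcc hT hy hv t,
      add_sub_cancel, restrictIcc_apply]
  have hzd : HasStrictFDerivAt z Zl (w₀, v₀) := Zl.hasStrictFDerivAt.const_add z₀
  set q := forgetVelocity X Y T
  set J := fun p => primitive hT (superpose L (z p)) τ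
  set G := fun p : C(Icc (0 : ℝ) T, X) × C(Icc (0 : ℝ) T, Y) =>
    (p.1 - superpose R (q (z p)), primitive hT p.1 τ, primitive hT p.2 τ)
  have hJ : HasStrictFDerivAt J (((ContinuousMap.evalCLM ℝ τ).comp (primitive hT)).comp
      ((pointwiseApply aL).comp Zl)) (w₀, v₀) := by
    have h₁ : HasStrictFDerivAt (superpose L) (pointwiseApply aL) (z (w₀, v₀)) :=
      hasStrictFDerivAt_superpose hΩ hL _ (fun t => by rw [hz']; exact hzΩ t t.2) aL
        fun t => by rw [hz']; rfl
    exact (((ContinuousMap.evalCLM ℝ τ).comp (primitive hT)).hasStrictFDerivAt).comp _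
      (h₁.comp _ hzd)
  have hG : HasStrictFDerivAt G ((ContinuousLinearMap.fst ℝ _ _
        - (pointwiseApply aR).comp (q.comp Zl)).prod
      ((((ContinuousMap.evalCLM ℝ τ).comp (primitive hT)).comp (.fst ℝ _ _)).prod
        (((ContinuousMap.evalCLM ℝ τ).comp (primitive hT)).comp (.snd ℝ _ _)))) (w₀, v₀) := by
    have h₁ : HasStrictFDerivAt (superpose R) (pointwiseApply aR) (q (z (w₀, v₀))) :=
      hasStrictFDerivAt_superpose hΘ hR _
        (fun t => by rw [forgetVelocity_apply, hz']; exact hzΘ t t.2) aR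
        fun t => by rw [forgetVelocity_apply, hz']; rfl
    have h₂ : HasStrictFDerivAt (fun p => q (z p)) (q.comp Zl) (w₀, v₀) :=
      (q.hasStrictFDerivAt (x := z (w₀, v₀))).comp _ hzd
    have h₃ := (((ContinuousMap.evalCLM ℝ τ).comp (primitive (E := X) hT)).comp
      (.fst ℝ _ C(Icc (0 : ℝ) T, Y))).hasStrictFDerivAt (x := (w₀, v₀))
    have h₄ := (((ContinuousMap.evalCLM ℝ τ).comp (primitive (E := Y) hT)).comp
      (.snd ℝ C(Icc (0 : ℝ) T, X) _)).hasStrictFDerivAt (x := (w₀, v₀))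
    have h₅ : HasStrictFDerivAt (fun p => superpose R (q (z p)))
        ((pointwiseApply aR).comp (q.comp Zl)) (w₀, v₀) :=
      HasStrictFDerivAt.comp (f := fun p => q (z p)) (w₀, v₀) h₁ h₂
    exact (hasStrictFDerivAt_fst.sub h₅).prodMk (h₃.prodMk h₄)
  have hext : IsLocalExtrOn J {p | G p = G (w₀, v₀)} (w₀, v₀) := by
    refine Or.inl ?_
    obtain ⟨r₁, hr₁, h₁⟩ := exists_forall_mem_of_dist_lt hΩ (z (w₀, v₀))
      (fun t => by rw [hz']; exact hzΩ t t.2)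
    obtain ⟨r₂, hr₂, h₂⟩ := exists_forall_mem_of_dist_lt hΘ (q (z (w₀, v₀)))
      (fun t => by rw [forgetVelocity_apply, hz']; exact hzΘ t t.2)
    have hb₁ := hzd.continuousAt (Metric.ball_mem_nhds _ (lt_min hr₁ hδ))
    have hb₂ := (q.continuous.continuousAt.comp hzd.continuousAt) (Metric.ball_mem_nhds _ hr₂)
    filter_upwards [mem_nhdsWithin_of_mem_nhds hb₁, mem_nhdsWithin_of_mem_nhds hb₂,
      self_mem_nhdsWithin] with p hp₁ hp₂ hp₃
    have hd : ∀ t, dist (z p t) (z (w₀, v₀) t) < min r₁ δ := fun t =>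
      (ContinuousMap.dist_apply_le_dist t).trans_lt hp₁
    have hpΩ : ∀ t, z p t ∈ Ω := fun t => h₁ t _ ((hd t).trans_le (min_le_left _ _))
    have hpΘ : ∀ t, q (z p) t ∈ Θ := fun t =>
      h₂ t _ ((ContinuousMap.dist_apply_le_dist t).trans_lt hp₂)
    have hz₀Ω : ∀ t, z (w₀, v₀) t ∈ Ω := fun t => by rw [hz']; exact hzΩ t t.2
    have hz₀Θ : ∀ t, q (z (w₀, v₀)) t ∈ Θ := fun t => by
      rw [forgetVelocity_apply, hz']; exact hzΘ t t.2
    obtain ⟨g₁, g₂, g₃⟩ : p.1 - superpose R (q (z p)) = w₀ - superpose R (q (z (w₀, v₀))) ∧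
        primitive hT p.1 τ = primitive hT w₀ τ ∧ primitive hT p.2 τ = primitive hT v₀ τ := by
      have : G p = G (w₀, v₀) := hp₃
      simpa only [G, Prod.mk.injEq] using this
    have g₁' : ∀ t, p.1 t = R (x 0 + primitive hT p.1 t, y 0 + primitive hT p.2 t) := fun t => by
      have e := DFunLike.congr_fun g₁ t
      simp only [ContinuousMap.sub_apply] at e
      rw [superpose_apply hR.continuousOn hpΘ, superpose_apply hR.continuousOn hz₀Θ,
        forgetVelocity_apply, forgetVelocity_apply, hz', hz] at e
      simpa [w₀, sub_eq_zero] using e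
    have hend : x 0 + primitive hT p.1 τ = x T ∧ y 0 + primitive hT p.2 τ = y T := by
      rw [g₂, g₃, primitive_restrictIcc hT hx hwc, primitive_restrictIcc hT hy hv]
      simp [τ]
    have := hmin (fun t => x 0 + ∫ s in (0 : ℝ)..t, IccExtend hT p.1 s)
      (fun t => y 0 + ∫ s in (0 : ℝ)..t, IccExtend hT p.2 s) (IccExtend hT p.2)
      (p.2.continuous.Icc_extend').continuousOn (fun t ht => ?_) (fun t ht => ?_) (by simp)
      (by simp) hend.1 hend.2 (fun t ht => ?_)
    · change (∫ s in (0 : ℝ)..T, IccExtend hT (superpose L (z (w₀, v₀))) s)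
        ≤ ∫ s in (0 : ℝ)..T, IccExtend hT (superpose L (z p)) s
      rw [integral_IccExtend_eq hT (f := fun t => L (x t, y t, v t)) fun t => by
        rw [superpose_apply hL.continuousOn hz₀Ω, hz']]
      refine this.trans_eq (integral_IccExtend_eq hT fun t => ?_).symm
      rw [superpose_apply hL.continuousOn hpΩ, hz, IccExtend_val]
      rfl
    · refine ((hasDerivWithinAt_integral_IccExtend hT p.1 ht).const_add (x 0)).congr_deriv ?_
      exact g₁' ⟨t, ht⟩
    · refine ((hasDerivWithinAt_integral_IccExtend hT p.2 ht).const_add (y 0)).congr_deriv ?_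
      rw [IccExtend_of_mem _ _ ht]
    · have := (hd ⟨t, ht⟩).trans_le (min_le_right _ _)
      rw [hz', hz] at this
      rw [IccExtend_of_mem _ _ ht]
      exact this
  obtain ⟨Λ, μ, hne, h⟩ := hext.exists_linear_map_of_hasStrictFDerivAt hG hJ
  refine ⟨Λ, μ, hne, fun w' v' f hf => ?_⟩
  have := h (w', v')
  have hf' : f = w' - pointwiseApply aR (q (Zl (w', v'))) := by
    ext t
    rw [hf]
    simp only [ContinuousMap.sub_apply, pointwiseApply_apply]
    rw [forgetVelocity_apply, velocityLift_apply]
    rfl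
  rw [hf']
  refine Eq.trans ?_ this
  rw [smul_eq_mul]
  congr 2
  refine (integral_IccExtend_eq hT fun t => ?_).symm
  have e := velocityLift_apply hT w' v' t
  rw [IccExtend_val, ← e]
  rfl

/-- Solvability of the linearized constraint `w - aR (∫ w, ∫ v) = f`. -/
theorem exists_linearized_velocity [CompleteSpace X] (hT : 0 ≤ T) {aR : ℝ → X × Y →L[ℝ] X}
    (haR : ContinuousOn aR (Icc 0 T)) (v : C(Icc (0 : ℝ) T, Y)) (f : C(Icc (0 : ℝ) T, X)) :
    ∃ (w : C(Icc (0 : ℝ) T, X)) (ξ : ℝ → X), ξ 0 = 0 ∧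
      (∀ t, primitive hT w t = ξ t) ∧
      (∀ t, f t = w t - aR t (primitive hT w t, primitive hT v t)) ∧
      ∀ (t : ℝ) (ht : t ∈ Icc 0 T), HasDerivWithinAt ξ (w ⟨t, ht⟩) (Icc 0 T) t := by
  have hη : Continuous (IccExtend hT (primitive hT v)) := (primitive hT v).continuous.Icc_extend'
  have hf : Continuous (IccExtend hT f) := f.continuous.Icc_extend'
  have hA : ContinuousOn (fun t => (aR t).comp (.inl ℝ X Y)) (Icc 0 T) :=
    haR.clm_comp continuousOn_const
  have hb : ContinuousOn (fun t => aR t (0, IccExtend hT (primitive hT v) t) + IccExtend hT f t)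
      (Icc 0 T) :=
    (haR.clm_apply (continuous_const.prodMk hη).continuousOn).add hf.continuousOn
  obtain ⟨ξ, hξ0, hξ⟩ := exists_linear_ode_solution hT hA hb 0
  have hξc : ContinuousOn ξ (Icc 0 T) := fun t ht => (hξ t ht).continuousWithinAt
  have hw : ContinuousOn (fun t => (aR t).comp (.inl ℝ X Y) (ξ t) +
      (aR t (0, IccExtend hT (primitive hT v) t) + IccExtend hT f t)) (Icc 0 T) :=
    (hA.clm_apply hξc).add hb
  have hprim := primitive_restrictIcc hT hξ hw
  simp only [hξ0, sub_zero] at hprim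
  refine ⟨restrictIcc T _ hw, ξ, hξ0, hprim, fun t => ?_, fun t ht => hξ t ht⟩
  rw [hprim, restrictIcc_apply]
  have e : ((ξ t, primitive hT v t) : X × Y) = (ξ t, 0) + (0, primitive hT v t) := by simp
  rw [e, map_add, IccExtend_val, IccExtend_val]
  simp only [ContinuousLinearMap.comp_apply, ContinuousLinearMap.inl_apply]
  abel

/-- Weak local minimizers of `∫ L(x, y, ẏ)` subject to `ẋ = R(x, y)` with fixed end points are
normal or abnormal extremals. -/
theorem exists_eulerLagrange_of_weakLocalMin [FiniteDimensional ℝ X] [FiniteDimensional ℝ Y]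
    (hT : 0 < T)
    {L : X × Y × Y → ℝ} {R : X × Y → X} {Ω : Set (X × Y × Y)} {Θ : Set (X × Y)}
    (hΩ : IsOpen Ω) (hΘ : IsOpen Θ) (hL : ContDiffOn ℝ 1 L Ω) (hR : ContDiffOn ℝ 1 R Θ)
    {x : ℝ → X} {y v : ℝ → Y} (hv : ContinuousOn v (Icc 0 T))
    (hx : ∀ t ∈ Icc 0 T, HasDerivWithinAt x (R (x t, y t)) (Icc 0 T) t)
    (hy : ∀ t ∈ Icc 0 T, HasDerivWithinAt y (v t) (Icc 0 T) t)
    (hzΩ : ∀ t ∈ Icc 0 T, (x t, y t, v t) ∈ Ω) (hzΘ : ∀ t ∈ Icc 0 T, (x t, y t) ∈ Θ)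
    {δ : ℝ} (hδ : 0 < δ)
    (hmin : ∀ (x' : ℝ → X) (y' v' : ℝ → Y), ContinuousOn v' (Icc 0 T) →
      (∀ t ∈ Icc 0 T, HasDerivWithinAt x' (R (x' t, y' t)) (Icc 0 T) t) →
      (∀ t ∈ Icc 0 T, HasDerivWithinAt y' (v' t) (Icc 0 T) t) →
      x' 0 = x 0 → y' 0 = y 0 → x' T = x T → y' T = y T →
      (∀ t ∈ Icc 0 T, dist (x' t, y' t, v' t) (x t, y t, v t) < δ) →
      ∫ t in (0 : ℝ)..T, L (x t, y t, v t) ≤ ∫ t in (0 : ℝ)..T, L (x' t, y' t, v' t)) :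
    ∃ (μ : ℝ) (lam : ℝ → X →L[ℝ] ℝ), (μ = 1 ∨ (μ = 0 ∧ lam T ≠ 0)) ∧
      ContinuousOn lam (Icc 0 T) ∧
      EulerLagrange T (fun t => μ • fderiv ℝ L (x t, y t, v t))
        (fun t => fderiv ℝ R (x t, y t)) lam := by
  have : CompleteSpace X := FiniteDimensional.complete ℝ X
  have : CompleteSpace Y := FiniteDimensional.complete ℝ Y
  have hxc : ContinuousOn x (Icc 0 T) := fun t ht => (hx t ht).continuousWithinAt
  have hyc : ContinuousOn y (Icc 0 T) := fun t ht => (hy t ht).continuousWithinAt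
  obtain ⟨Λ, μ, hne, hΛ⟩ : ∃ (Λ : Module.Dual ℝ (C(Icc (0 : ℝ) T, X) × X × Y)) (μ : ℝ),
      (μ = 1 ∨ (μ = 0 ∧ Λ ≠ 0)) ∧
      ∀ (w' : C(Icc (0 : ℝ) T, X)) (v' : C(Icc (0 : ℝ) T, Y)) (f : C(Icc (0 : ℝ) T, X)),
        (∀ t, f t = w' t
          - fderiv ℝ R (x t, y t) (primitive hT.le w' t, primitive hT.le v' t)) →
        Λ (f, primitive hT.le w' ⟨T, right_mem_Icc.2 hT.le⟩,
            primitive hT.le v' ⟨T, right_mem_Icc.2 hT.le⟩)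
          + μ * ∫ t in (0 : ℝ)..T, IccExtend hT.le (fun t : Icc (0 : ℝ) T =>
            fderiv ℝ L (x t, y t, v t) (primitive hT.le w' t, primitive hT.le v' t, v' t)) t
          = 0 := by
    obtain ⟨Λ, μ, hne, hΛ⟩ := exists_functional_of_weakLocalMin hT.le hΩ hΘ hL hR hv hx hy hzΩ hzΘ
      hδ hmin
    by_cases hμ : μ = 0
    · exact ⟨Λ, μ, Or.inr ⟨hμ, fun h => hne (by rw [h, hμ]; rfl)⟩, hΛ⟩
    · refine ⟨μ⁻¹ • Λ, 1, Or.inl rfl, fun w' v' f hf => ?_⟩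
      have h := congrArg (fun a => μ⁻¹ * a) (hΛ w' v' f hf)
      simpa only [mul_add, ← mul_assoc, inv_mul_cancel₀ hμ, mul_zero, LinearMap.smul_apply,
        smul_eq_mul] using h
  set aL : ℝ → X × Y × Y →L[ℝ] ℝ := fun t => μ • fderiv ℝ L (x t, y t, v t)
  set aR : ℝ → X × Y →L[ℝ] X := fun t => fderiv ℝ R (x t, y t)
  have haL : ContinuousOn aL (Icc 0 T) := ((hL.continuousOn_fderiv_of_isOpen hΩ le_rfl).comp
    (hxc.prodMk (hyc.prodMk hv)) hzΩ).const_smul μ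
  have haR : ContinuousOn aR (Icc 0 T) :=
    (hR.continuousOn_fderiv_of_isOpen hΘ le_rfl).comp (hxc.prodMk hyc) hzΘ
  set pX : X →L[ℝ] ℝ := LinearMap.toContinuousLinearMap
    (Λ ∘ₗ LinearMap.inr ℝ _ (X × Y) ∘ₗ LinearMap.inl ℝ X Y)
  set pY : Y →L[ℝ] ℝ := LinearMap.toContinuousLinearMap
    (Λ ∘ₗ LinearMap.inr ℝ _ (X × Y) ∘ₗ LinearMap.inr ℝ X Y)
  have hsplit : ∀ f a b, Λ (f, a, b) = Λ (f, 0, 0) + pX a + pY b := fun f a b => by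
    have : ((f, a, b) : C(Icc (0 : ℝ) T, X) × X × Y) = (f, 0, 0) + (0, a, 0) + (0, 0, b) := by
      simp
    rw [this, map_add, map_add]
    rfl
  obtain ⟨lam, hlamT, hlam⟩ := exists_linear_ode_solution_terminal hT.le
    (A := fun t => -(ContinuousLinearMap.compL ℝ X X ℝ).flip ((aR t).comp (.inl ℝ X Y)))
    (f := fun t => (aL t).comp (.inl ℝ X (Y × Y)))
    (((ContinuousLinearMap.compL ℝ X X ℝ).flip.continuous.comp_continuousOn
      (haR.clm_comp continuousOn_const)).neg) (haL.clm_comp continuousOn_const) (-pX)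
  have hlam' : ∀ t ∈ Icc 0 T, HasDerivWithinAt lam
      ((aL t).comp (.inl ℝ X (Y × Y)) - (lam t).comp ((aR t).comp (.inl ℝ X Y))) (Icc 0 T) t :=
    fun t ht => (hlam t ht).congr_deriv (by
      ext e
      simp [sub_eq_neg_add])
  have hlamc : ContinuousOn lam (Icc 0 T) := fun t ht => (hlam t ht).continuousWithinAt
  -- the reduced multiplier rule, in which only the variation of `y` is left
  have hred : ∀ (η η' : ℝ → Y), (∀ t ∈ Icc 0 T, HasDerivWithinAt η (η' t) (Icc 0 T) t) →
      ContinuousOn η' (Icc 0 T) → η 0 = 0 →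
      pY (η T) + ∫ t in (0 : ℝ)..T,
        (aL t (0, η t, 0) - lam t (aR t (0, η t)) + aL t (0, 0, η' t)) = 0 := by
    intro η η' hη hη' hη0
    have hηc : ContinuousOn η (Icc 0 T) := fun t ht => (hη t ht).continuousWithinAt
    obtain ⟨w, ξ, hξ0, hwξ, hwf, hξ⟩ := exists_linearized_velocity hT.le haR
      (restrictIcc T η' hη') 0
    have hηp := primitive_restrictIcc hT.le hη hη'
    simp only [hη0, sub_zero] at hηp
    have hξc : ContinuousOn ξ (Icc 0 T) := fun t ht => (hξ t ht).continuousWithinAt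
    have h₁ := hΛ w (restrictIcc T η' hη') 0 hwf
    have hwf' : ∀ (t : ℝ) (ht : t ∈ Icc 0 T), w ⟨t, ht⟩ = aR t (ξ t, η t) := fun t ht => by
      have := hwf ⟨t, ht⟩
      rw [hwξ, hηp] at this
      exact (sub_eq_zero.1 this.symm)
    rw [hsplit, hwξ, hηp, ← intervalIntegral.integral_const_mul] at h₁
    have e₁ : ∫ t in (0 : ℝ)..T, μ * IccExtend hT.le (fun t : Icc (0 : ℝ) T =>
          fderiv ℝ L (x t, y t, v t) (primitive hT.le w t,
            primitive hT.le (restrictIcc T η' hη') t, restrictIcc T η' hη' t)) t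
        = ∫ t in (0 : ℝ)..T, aL t (ξ t, η t, η' t) := by
      refine intervalIntegral.integral_congr fun t ht => ?_
      rw [uIcc_of_le hT.le] at ht
      simp only [IccExtend_of_mem _ _ ht, hwξ, hηp, restrictIcc_apply]
      rfl
    have h₂ := integral_eq_sub_of_hasDerivWithinAt_Icc (T := T) (t := T)
      (f := fun t => lam t (ξ t)) (f' := fun t => aL t (ξ t, 0, 0) + lam t (aR t (0, η t)))
      (fun t ht => ((hlam' t ht).clm_apply (hξ t ht)).congr_deriv (by
        have e : ((ξ t, η t) : X × Y) = (ξ t, 0) + (0, η t) := by simp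
        rw [hwf' t ht, e, map_add, map_add]
        simp only [sub_apply, ContinuousLinearMap.comp_apply, ContinuousLinearMap.inl_apply]
        rw [← Prod.mk_zero_zero]
        ring))
      ((haL.clm_apply (hξc.prodMk continuousOn_const)).add
        (hlamc.clm_apply (haR.clm_apply (continuousOn_const.prodMk hηc)))) (right_mem_Icc.2 hT.le)
    rw [hlamT, hξ0] at h₂
    have i₁ : IntervalIntegrable (fun t => aL t (ξ t, η t, η' t)) volume 0 T :=
      (haL.clm_apply (hξc.prodMk (hηc.prodMk hη'))).intervalIntegrable_of_Icc hT.le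
    have i₂ : IntervalIntegrable (fun t => aL t (ξ t, 0, 0) + lam t (aR t (0, η t))) volume 0 T :=
      ((haL.clm_apply (hξc.prodMk continuousOn_const)).add
        (hlamc.clm_apply (haR.clm_apply
          (continuousOn_const.prodMk hηc)))).intervalIntegrable_of_Icc hT.le
    have e₂ : ∫ t in (0 : ℝ)..T,
        (aL t (0, η t, 0) - lam t (aR t (0, η t)) + aL t (0, 0, η' t))
        = (∫ t in (0 : ℝ)..T, aL t (ξ t, η t, η' t))
          - ∫ t in (0 : ℝ)..T, (aL t (ξ t, 0, 0) + lam t (aR t (0, η t))) := by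
      rw [← intervalIntegral.integral_sub i₁ i₂]
      refine intervalIntegral.integral_congr fun t _ => ?_
      have e : ((ξ t, η t, η' t) : X × Y × Y)
          = (ξ t, 0, 0) + (0, η t, 0) + (0, 0, η' t) := by simp
      rw [e, map_add, map_add]
      ring
    rw [e₂, h₂, ← e₁]
    have : Λ (0, 0, 0) = 0 := map_zero Λ
    rw [this] at h₁
    simp only [neg_apply, map_zero, sub_zero]
    linarith
  refine ⟨μ, lam, ?_, hlamc, fun t ht e => ?_, fun t ht e => ?_⟩
  · refine hne.imp_right fun ⟨hμ, hΛ0⟩ => ⟨hμ, fun h0 => hΛ0 ?_⟩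
    have hpX : pX = 0 := by rw [← neg_eq_zero, ← hlamT, h0]
    have hpY : pY = 0 := by
      ext b
      have hη : ∀ t ∈ Icc 0 T, HasDerivWithinAt (fun t : ℝ => (t / T) • b) ((1 / T) • b)
          (Icc 0 T) t := fun t _ =>
        (((hasDerivAt_id t).div_const T).smul_const b).hasDerivWithinAt
      have hηp := primitive_restrictIcc hT.le hη continuousOn_const
        ⟨T, right_mem_Icc.2 hT.le⟩
      obtain ⟨w, ξ, -, -, hwf, -⟩ := exists_linearized_velocity hT.le haR
        (restrictIcc T _ (continuousOn_const (c := (1 / T) • b))) 0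
      have h₁ := hΛ w _ 0 hwf
      have h₀ : Λ (0, 0, 0) = 0 := map_zero Λ
      rw [hsplit, hpX, hμ, h₀, hηp] at h₁
      simpa [hT.ne'] using h₁
    refine LinearMap.ext fun ⟨f, a, b⟩ => ?_
    obtain ⟨w, ξ, -, -, hwf, -⟩ := exists_linearized_velocity hT.le haR 0 f
    have := hΛ w 0 f hwf
    rw [hsplit, hpX, hpY, hμ] at this
    rw [hsplit, hpX, hpY]
    simpa using this
  · have := (hlam' t ht).clm_apply (hasDerivWithinAt_const t (Icc 0 T) e)
    refine this.congr_deriv ?_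
    simp only [sub_apply, ContinuousLinearMap.comp_apply, ContinuousLinearMap.inl_apply, map_zero,
      add_zero]
    rfl
  · refine hasDerivWithinAt_of_forall_integral_eq_zero hT
      (a := fun t => aL t (0, e, 0) - lam t (aR t (0, e)))
      ((haL.clm_apply continuousOn_const).sub
        (hlamc.clm_apply (haR.clm_apply continuousOn_const)))
      (haL.clm_apply continuousOn_const) (fun η hη h0 hT' => ?_) t ht
    have := hred (fun t => η t • e) (fun t => deriv η t • e)
      (fun t _ => ((hη.differentiable one_ne_zero t).hasDerivAt.smul_const e).hasDerivWithinAt)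
      ((hη.continuous_deriv le_rfl).smul continuous_const).continuousOn (by simp [h0])
    rw [hT', zero_smul, map_zero, zero_add] at this
    refine Eq.trans (intervalIntegral.integral_congr fun s _ => ?_) this
    have e₁ : ((0, η s • e, 0) : X × Y × Y) = η s • (0, e, 0) := by simp
    have e₂ : ((0, η s • e) : X × Y) = η s • (0, e) := by simp
    have e₃ : ((0, 0, deriv η s • e) : X × Y × Y) = deriv η s • (0, 0, e) := by simp
    rw [e₁, e₂, e₃]
    simp only [map_smul, smul_eq_mul]
    ring

end Multipliers

end NonholonomicControl

namespace NonholonomicControl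

theorem contDiff_matrix_det {ι : Type*} [Fintype ι] [DecidableEq ι] {N : WithTop ℕ∞} :
    ContDiff ℝ N (fun A : ι → ι → ℝ => (Matrix.of A).det) := by
  simp only [Matrix.det_apply, Matrix.of_apply]
  fun_prop

theorem contDiffAt_matrix_inv {ι : Type*} [Fintype ι] [DecidableEq ι] {N : WithTop ℕ∞}
    {A : ι → ι → ℝ} (hA : IsUnit (Matrix.of A).det) (i j : ι) :
    ContDiffAt ℝ N (fun A : ι → ι → ℝ => (Matrix.of A)⁻¹ i j) A := by
  have h : (fun A : ι → ι → ℝ => (Matrix.of A)⁻¹ i j) = fun A : ι → ι → ℝ =>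
      ((Matrix.of A).det)⁻¹ * (Matrix.of (Function.update A j (Pi.single i 1))).det := by
    funext A
    rw [Matrix.inv_def, Matrix.smul_apply, Matrix.adjugate_apply, Ring.inverse_eq_inv', smul_eq_mul]
    rfl
  rw [h]
  refine (contDiff_matrix_det.contDiffAt.inv hA.ne_zero).mul
    (contDiff_matrix_det.contDiffAt.comp A ?_)
  refine contDiffAt_pi.2 fun k => ?_
  by_cases hk : k = j
  · subst hk
    simpa using contDiffAt_const
  · simp only [Function.update_of_ne hk]
    fun_prop

variable {n m : ℕ} {Q : Type*} [TopologicalSpace Q]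
    [ChartedSpace (EuclideanSpace ℝ (Fin n)) Q] [IsManifold (𝓡 n) ∞ Q]
    {D : Q → Type*} [TopologicalSpace (TotalSpace (EuclideanSpace ℝ (Fin m)) D)]
    [∀ x, AddCommGroup (D x)] [∀ x, Module ℝ (D x)] [∀ x, TopologicalSpace (D x)]
    [FiberBundle (EuclideanSpace ℝ (Fin m)) D] [VectorBundle ℝ (EuclideanSpace ℝ (Fin m)) D]
    [ContMDiffVectorBundle ∞ (EuclideanSpace ℝ (Fin m)) D (𝓡 n)]

namespace System

variable (S : System n m Q D)

@[simp] theorem frame_apply (x : Q) (A : Fin m) : S.frame x A = S.input A x := by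
  simp [frame]

theorem frame_repr_sum (x : Q) (c : Fin m → ℝ) (A : Fin m) :
    (S.frame x).repr (∑ B, c B • S.input B x) A = c A := by
  have : ∑ B, c B • S.input B x = ∑ B, c B • S.frame x B := by simp
  rw [this, Module.Basis.repr_sum_self]

theorem sum_coord_smul (v : TotalSpace (EuclideanSpace ℝ (Fin m)) D) :
    ∑ A, S.coord v A • S.input A v.proj = v.snd := by
  simpa [coord] using (S.frame v.proj).sum_repr v.snd

theorem coord_point (x : Q) (y : Fin m → ℝ) : S.coord (S.point x y) = y :=
  funext fun A => S.frame_repr_sum x y A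

theorem point_coord (v : TotalSpace (EuclideanSpace ℝ (Fin m)) D) :
    S.point v.proj (S.coord v) = v := by
  unfold point
  rw [S.sum_coord_smul]

theorem contMDiffAt_trivialization_input (A : Fin m) (x₀ : Q) :
    ContMDiffAt (𝓡 n) 𝓘(ℝ, EuclideanSpace ℝ (Fin m)) ∞ (fun x =>
      (trivializationAt (EuclideanSpace ℝ (Fin m)) D x₀ ⟨x, S.input A x⟩).2) x₀ :=
  (contMDiffAt_section x₀).1 ((S.input A).contMDiff x₀)

theorem trivialization_sum_input (x₀ x : Q)
    (hx : x ∈ (trivializationAt (EuclideanSpace ℝ (Fin m)) D x₀).baseSet) (y : Fin m → ℝ) :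
    (trivializationAt (EuclideanSpace ℝ (Fin m)) D x₀ ⟨x, ∑ A, y A • S.input A x⟩).2
      = ∑ A, y A • (trivializationAt (EuclideanSpace ℝ (Fin m)) D x₀ ⟨x, S.input A x⟩).2 := by
  have h := fun v => congrFun
    ((trivializationAt (EuclideanSpace ℝ (Fin m)) D x₀).coe_linearMapAt_of_mem (R := ℝ) hx) v
  simp only [← h, map_sum, map_smul]

theorem contMDiff_point : ContMDiff ((𝓡 n).prod 𝓘(ℝ, Fin m → ℝ))
    ((𝓡 n).prod 𝓘(ℝ, EuclideanSpace ℝ (Fin m))) ∞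
    (fun p : Q × (Fin m → ℝ) => S.point p.1 p.2) := by
  intro p₀
  refine contMDiffAt_totalSpace.2 ⟨contMDiffAt_fst, ?_⟩
  have hmem : ∀ᶠ p : Q × (Fin m → ℝ) in 𝓝 p₀,
      p.1 ∈ (trivializationAt (EuclideanSpace ℝ (Fin m)) D p₀.1).baseSet :=
    continuous_fst.continuousAt (Trivialization.open_baseSet _ |>.mem_nhds
      (mem_baseSet_trivializationAt _ _ _))
  refine ContMDiffAt.congr_of_eventuallyEq (f := fun p : Q × (Fin m → ℝ) => ∑ A, p.2 A •
    (trivializationAt (EuclideanSpace ℝ (Fin m)) D p₀.1 ⟨p.1, S.input A p.1⟩).2) ?_ ?_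
  · refine contMDiffAt_finsetSum fun A _ => ?_
    have h₁ : ContMDiffAt ((𝓡 n).prod 𝓘(ℝ, Fin m → ℝ)) 𝓘(ℝ, ℝ) ∞
        (fun p : Q × (Fin m → ℝ) => p.2 A) p₀ :=
      ((ContinuousLinearMap.proj (R := ℝ) (φ := fun _ : Fin m => ℝ) A).contMDiff.comp
        contMDiff_snd) p₀
    exact h₁.smul ((S.contMDiffAt_trivialization_input A p₀.1).comp p₀ contMDiffAt_fst)
  · filter_upwards [hmem] with p hp
    exact S.trivialization_sum_input p₀.1 p.1 hp p.2

theorem contMDiff_coord : ContMDiff ((𝓡 n).prod 𝓘(ℝ, EuclideanSpace ℝ (Fin m)))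
    𝓘(ℝ, Fin m → ℝ) ∞ S.coord := by
  intro v₀
  set e := trivializationAt (EuclideanSpace ℝ (Fin m)) D v₀.proj
  set M : Q → Fin m → Fin m → ℝ := fun x B A => (e ⟨x, S.input A x⟩).2 B
  have hproj : ContMDiffAt ((𝓡 n).prod 𝓘(ℝ, EuclideanSpace ℝ (Fin m))) (𝓡 n) ∞
      (fun v : TotalSpace (EuclideanSpace ℝ (Fin m)) D => v.proj) v₀ :=
    (contMDiffAt_totalSpace.1 contMDiffAt_id).1
  have hfib : ContMDiffAt ((𝓡 n).prod 𝓘(ℝ, EuclideanSpace ℝ (Fin m)))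
      𝓘(ℝ, EuclideanSpace ℝ (Fin m)) ∞
      (fun v : TotalSpace (EuclideanSpace ℝ (Fin m)) D => (e v).2) v₀ :=
    (contMDiffAt_totalSpace.1 contMDiffAt_id).2
  have hM : ContMDiffAt (𝓡 n) 𝓘(ℝ, Fin m → Fin m → ℝ) ∞ M v₀.proj := by
    refine contMDiffAt_pi_space.2 fun B => contMDiffAt_pi_space.2 fun A => ?_
    exact (EuclideanSpace.proj (𝕜 := ℝ) B).contMDiff.contMDiffAt.comp v₀.proj
      (S.contMDiffAt_trivialization_input A v₀.proj)
  have hx₀ : v₀.proj ∈ e.baseSet := mem_baseSet_trivializationAt _ _ _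
  have hmul : ∀ x ∈ e.baseSet, ∀ y : Fin m → ℝ, ∀ B,
      (Matrix.of (M x)).mulVec y B = (e ⟨x, ∑ A, y A • S.input A x⟩).2 B := by
    intro x hx y B
    rw [S.trivialization_sum_input v₀.proj x hx y]
    simp [Matrix.mulVec, dotProduct, M, e, mul_comm]
  have hunit : ∀ x ∈ e.baseSet, IsUnit (Matrix.of (M x)).det := by
    intro x hx
    rw [isUnit_iff_ne_zero]
    intro h
    obtain ⟨y, hy, hy0⟩ := Matrix.exists_mulVec_eq_zero_iff.2 h
    apply hy
    have h1 : (e.linearMapAt ℝ x) (∑ A, y A • S.input A x) = 0 := by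
      rw [e.coe_linearMapAt_of_mem hx]
      ext B
      rw [← hmul x hx, hy0]
      rfl
    have h2 : ∑ A, y A • S.input A x = 0 := by
      have := e.symmₗ_linearMapAt (R := ℝ) hx (∑ A, y A • S.input A x)
      rw [← this, h1, map_zero]
    exact funext (Fintype.linearIndependent_iff.1 (S.input_linearIndependent x) y h2)
  have hmem : ∀ᶠ v : TotalSpace (EuclideanSpace ℝ (Fin m)) D in 𝓝 v₀, v.proj ∈ e.baseSet :=
    hproj.continuousAt (e.open_baseSet.mem_nhds hx₀)
  refine contMDiffAt_pi_space.2 fun A => ?_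
  refine ContMDiffAt.congr_of_eventuallyEq (f := fun v => ∑ B,
    (Matrix.of (M v.proj))⁻¹ A B * (e v).2 B) ?_ ?_
  · refine contMDiffAt_finsetSum fun B _ => ContMDiffAt.mul ?_ ?_
    · have h1 : ContMDiffAt 𝓘(ℝ, Fin m → Fin m → ℝ) 𝓘(ℝ, ℝ) ∞
          (fun N : Fin m → Fin m → ℝ => (Matrix.of N)⁻¹ A B) (M v₀.proj) :=
        (contDiffAt_matrix_inv (hunit _ hx₀) A B).contMDiffAt
      exact h1.comp v₀ (hM.comp v₀ hproj)
    · exact (EuclideanSpace.proj (𝕜 := ℝ) B).contMDiff.contMDiffAt.comp v₀ hfib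
  · filter_upwards [hmem] with v hv
    have h1 : (Matrix.of (M v.proj)).mulVec (S.coord v) = fun B => (e v).2 B := by
      funext B
      rw [hmul _ hv, S.sum_coord_smul]
    have h2 := congrArg (fun z => (Matrix.of (M v.proj))⁻¹.mulVec z A) h1
    simp only [Matrix.mulVec_mulVec, Matrix.nonsing_inv_mul _ (hunit _ hv), Matrix.one_mulVec] at h2
    exact h2

theorem contMDiff_anchor_section (X : Cₛ^∞⟮𝓡 n; EuclideanSpace ℝ (Fin m), D⟯) :
    ContMDiff (𝓡 n) (𝓡 n).tangent ∞
      (fun x => (⟨x, S.anchor x (X x)⟩ : TangentBundle (𝓡 n) Q)) :=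
  S.anchor_smooth.comp X.contMDiff

theorem contMDiff_lieDeriv (X : Cₛ^∞⟮𝓡 n; EuclideanSpace ℝ (Fin m), D⟯) {f : Q → ℝ}
    (hf : ContMDiff (𝓡 n) 𝓘(ℝ, ℝ) ∞ f) : ContMDiff (𝓡 n) 𝓘(ℝ, ℝ) ∞ (S.lieDeriv X f) :=
  (contMDiff_snd_tangentBundle_modelSpace ℝ 𝓘(ℝ, ℝ)).comp
    ((hf.contMDiff_tangentMap (m := ∞) (by simp)).comp (S.contMDiff_anchor_section X))

theorem contMDiff_gram_inv (A B : Fin m) :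
    ContMDiff (𝓡 n) 𝓘(ℝ, ℝ) ∞ (fun x => (S.gram x)⁻¹ A B) := by
  intro x
  have h1 : ContMDiffAt 𝓘(ℝ, Fin m → Fin m → ℝ) 𝓘(ℝ, ℝ) ∞
      (fun N : Fin m → Fin m → ℝ => (Matrix.of N)⁻¹ A B) (S.gram x) :=
    (contDiffAt_matrix_inv (S.gram_isUnit x) A B).contMDiffAt
  have h2 : ContMDiffAt (𝓡 n) 𝓘(ℝ, Fin m → Fin m → ℝ) ∞
      (fun x A B => S.gram x A B) x :=
    contMDiffAt_pi_space.2 fun B => contMDiffAt_pi_space.2 fun A =>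
      S.metric_smooth (S.input B) (S.input A) x
  exact h1.comp x h2

theorem contMDiff_koszul (X Y Z : Cₛ^∞⟮𝓡 n; EuclideanSpace ℝ (Fin m), D⟯) :
    ContMDiff (𝓡 n) 𝓘(ℝ, ℝ) ∞ (S.koszul X Y Z) :=
  (((((S.contMDiff_lieDeriv X (S.metric_smooth Y Z)).add
    (S.contMDiff_lieDeriv Y (S.metric_smooth X Z))).sub
    (S.contMDiff_lieDeriv Z (S.metric_smooth X Y))).add
    (S.metric_smooth X (S.bracket Z Y))).add (S.metric_smooth Y (S.bracket Z X))).sub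
    (S.metric_smooth Z (S.bracket Y X))

theorem contMDiff_christoffel (A B C : Fin m) :
    ContMDiff (𝓡 n) 𝓘(ℝ, ℝ) ∞ (S.christoffel A B C) := by
  have h : S.christoffel A B C = fun x => (1 / 2 : ℝ) *
      ∑ E, (S.gram x)⁻¹ C E * S.koszul (S.input A) (S.input B) (S.input E) x := by
    funext x
    exact S.frame_repr_sum x _ C
  rw [h]
  exact contMDiff_const.mul (contMDiff_finsetSum fun E _ =>
    (S.contMDiff_gram_inv C E).mul (S.contMDiff_koszul _ _ _))

theorem contMDiff_gradV_coeff (C : Fin m) :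
    ContMDiff (𝓡 n) 𝓘(ℝ, ℝ) ∞ (fun x => (S.frame x).repr (S.gradV x) C) := by
  have h : (fun x => (S.frame x).repr (S.gradV x) C) = fun x =>
      ∑ E, (S.gram x)⁻¹ C E * S.lieDeriv (S.input E) S.V x := by
    funext x
    exact S.frame_repr_sum x _ C
  rw [h]
  exact contMDiff_finsetSum fun E _ =>
    (S.contMDiff_gram_inv C E).mul (S.contMDiff_lieDeriv _ S.V.contMDiff)

theorem contMDiff_elimControl :
    ContMDiff ((𝓡 n).prod 𝓘(ℝ, (Fin m → ℝ) × (Fin m → ℝ))) 𝓘(ℝ, Fin m → ℝ) ∞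
      (fun p : Q × (Fin m → ℝ) × (Fin m → ℝ) => S.elimControl p.1 p.2.1 p.2.2) := by
  have hy : ∀ A : Fin m, ContMDiff ((𝓡 n).prod 𝓘(ℝ, (Fin m → ℝ) × (Fin m → ℝ))) 𝓘(ℝ, ℝ) ∞
      (fun p : Q × (Fin m → ℝ) × (Fin m → ℝ) => p.2.1 A) := fun A =>
    (by fun_prop : ContDiff ℝ ∞ fun q : (Fin m → ℝ) × (Fin m → ℝ) => q.1 A).contMDiff.comp
      contMDiff_snd
  have hv : ∀ A : Fin m, ContMDiff ((𝓡 n).prod 𝓘(ℝ, (Fin m → ℝ) × (Fin m → ℝ))) 𝓘(ℝ, ℝ) ∞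
      (fun p : Q × (Fin m → ℝ) × (Fin m → ℝ) => p.2.2 A) := fun A =>
    (by fun_prop : ContDiff ℝ ∞ fun q : (Fin m → ℝ) × (Fin m → ℝ) => q.2 A).contMDiff.comp
      contMDiff_snd
  refine contMDiff_pi_space.2 fun C => ?_
  refine ((hv C).add (contMDiff_finsetSum fun A _ => contMDiff_finsetSum fun B _ => ?_)).add
    ((S.contMDiff_gradV_coeff C).comp contMDiff_fst)
  exact (((S.contMDiff_christoffel A B C).comp contMDiff_fst).mul (hy A)).mul (hy B)

end System

end NonholonomicControl

namespace NonholonomicControl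

variable {n m : ℕ} {Q : Type*} [TopologicalSpace Q] [ChartedSpace (EuclideanSpace ℝ (Fin n)) Q]

section Chart

variable {φ : OpenPartialHomeomorph Q (EuclideanSpace ℝ (Fin n))}

theorem mdifferentiable_of_mem_maximalAtlas (hφ : φ ∈ IsManifold.maximalAtlas (𝓡 n) ∞ Q) :
    φ.MDifferentiable (𝓡 n) (𝓡 n) :=
  ⟨fun _ hx => ((contMDiffOn_of_mem_maximalAtlas hφ).mdifferentiableOn (by simp)) _ hx,
    fun _ hx => ((contMDiffOn_symm_of_mem_maximalAtlas hφ).mdifferentiableOn (by simp)) _ hx⟩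

theorem hasDerivWithinAt_iff_hasMFDerivWithinAt_smulRight {E : Type*} [NormedAddCommGroup E]
    [NormedSpace ℝ E] (f : ℝ → E) (η : E) {s : Set ℝ} {t : ℝ} :
    HasDerivWithinAt f η s t ↔
      HasMFDerivWithinAt 𝓘(ℝ, ℝ) 𝓘(ℝ, E) f s t ((1 : ℝ →L[ℝ] ℝ).smulRight η) := by
  have : ContinuousLinearMap.toSpanSingleton ℝ η = (1 : ℝ →L[ℝ] ℝ).smulRight η := by
    ext; simp
  rw [hasDerivWithinAt_iff_hasFDerivWithinAt, this]
  exact hasMFDerivWithinAt_iff_hasFDerivWithinAt.symm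

/-- The velocity of a curve in `Q`, read in a chart. -/
theorem hasMFDerivWithinAt_curve_iff (hφ : φ ∈ IsManifold.maximalAtlas (𝓡 n) ∞ Q) {q : ℝ → Q}
    {s : Set ℝ} (hq : ∀ t ∈ s, q t ∈ φ.source) {t : ℝ} (ht : t ∈ s) (ξ : TangentSpace (𝓡 n) (q t)) :
    HasMFDerivWithinAt 𝓘(ℝ, ℝ) (𝓡 n) q s t ((1 : ℝ →L[ℝ] ℝ).smulRight ξ) ↔
      HasDerivWithinAt (fun r => φ (q r))
        (show EuclideanSpace ℝ (Fin n) from mfderiv (𝓡 n) (𝓡 n) φ (q t) ξ) s t := by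
  have hd := mdifferentiable_of_mem_maximalAtlas hφ
  have hφd := (hd.mdifferentiableAt (hq t ht)).hasMFDerivAt
  have hφs := (hd.mdifferentiableAt_symm (φ.map_source (hq t ht))).hasMFDerivAt
  set η : EuclideanSpace ℝ (Fin n) := mfderiv (𝓡 n) (𝓡 n) φ (q t) ξ with hη
  have hη' : mfderiv (𝓡 n) (𝓡 n) φ.symm (φ (q t)) η = ξ :=
    DFunLike.congr_fun (hd.symm_comp_deriv (hq t ht)) ξ
  change _ ↔ HasDerivWithinAt (fun r => φ (q r)) η s t
  refine Iff.trans ?_ (hasDerivWithinAt_iff_hasMFDerivWithinAt_smulRight _ η).symm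
  constructor
  · intro h
    refine (hφd.comp_hasMFDerivWithinAt t h).congr_mfderiv (ContinuousLinearMap.ext fun c => ?_)
    exact map_smul (mfderiv (𝓡 n) (𝓡 n) φ (q t)) (show ℝ from c) ξ
  · intro h
    have h1 := hφs.comp_hasMFDerivWithinAt (f := fun r => φ (q r)) t h
    have h2 := HasMFDerivWithinAt.congr_of_eventuallyEq (f₁ := q) h1
      (Filter.eventually_of_mem self_mem_nhdsWithin fun r hr => (φ.left_inv (hq r hr)).symm)
      (φ.left_inv (hq t ht)).symm
    refine HasMFDerivWithinAt.congr_mfderiv h2 (ContinuousLinearMap.ext fun c => ?_)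
    have h3 := map_smul (mfderiv (𝓡 n) (𝓡 n) φ.symm (φ (q t))) (show ℝ from c) η
    exact h3.trans (congrArg (fun w : EuclideanSpace ℝ (Fin n) => (show ℝ from c) • w) hη')

theorem contMDiffOn_chart_symm_fst {E : Type*} [NormedAddCommGroup E] [NormedSpace ℝ E]
    (hφ : φ ∈ IsManifold.maximalAtlas (𝓡 n) ∞ Q) :
    ContMDiffOn 𝓘(ℝ, EuclideanSpace ℝ (Fin n) × E) (𝓡 n) ∞
      (fun z : EuclideanSpace ℝ (Fin n) × E => φ.symm z.1) {z | z.1 ∈ φ.target} :=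
  (contMDiffOn_symm_of_mem_maximalAtlas hφ).comp
    (contMDiffOn_iff_contDiffOn.2 contDiffOn_fst) fun _ hz => hz

theorem contDiffOn_chart_comp (hφ : φ ∈ IsManifold.maximalAtlas (𝓡 n) ∞ Q) {q : ℝ → Q} {s : Set ℝ}
    (hq : ContMDiffOn 𝓘(ℝ, ℝ) (𝓡 n) 1 q s) (hs : ∀ t ∈ s, q t ∈ φ.source) :
    ContDiffOn ℝ 1 (fun t => φ (q t)) s :=
  contMDiffOn_iff_contDiffOn.1
    (((contMDiffOn_of_mem_maximalAtlas hφ).of_le (by simp)).comp hq hs)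

end Chart

variable [IsManifold (𝓡 n) ∞ Q]
    {D : Q → Type*} [TopologicalSpace (TotalSpace (EuclideanSpace ℝ (Fin m)) D)]
    [∀ x, AddCommGroup (D x)] [∀ x, Module ℝ (D x)] [∀ x, TopologicalSpace (D x)]
    [FiberBundle (EuclideanSpace ℝ (Fin m)) D] [VectorBundle ℝ (EuclideanSpace ℝ (Fin m)) D]
    [ContMDiffVectorBundle ∞ (EuclideanSpace ℝ (Fin m)) D (𝓡 n)]

namespace System

variable (S : System n m Q D) {φ : OpenPartialHomeomorph Q (EuclideanSpace ℝ (Fin n))}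

theorem contDiffOn_anchorCoeff (hφ : φ ∈ IsManifold.maximalAtlas (𝓡 n) ∞ Q) (A : Fin m)
    (i : Fin n) : ContDiffOn ℝ ∞ (S.anchorCoeff φ A i) φ.target := by
  have h1 : ContMDiffOn (𝓡 n) (𝓡 n).tangent ∞ (fun x =>
      (⟨φ.symm x, S.anchor (φ.symm x) (S.input A (φ.symm x))⟩ : TangentBundle (𝓡 n) Q))
      φ.target :=
    (S.contMDiff_anchor_section (S.input A)).comp_contMDiffOn
      (contMDiffOn_symm_of_mem_maximalAtlas hφ)
  have h2 := (contMDiffOn_of_mem_maximalAtlas hφ).contMDiffOn_tangentMapWithin (m := ∞) (by simp)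
    φ.open_source.uniqueMDiffOn
  have h3 : ContMDiffOn (𝓡 n) 𝓘(ℝ, EuclideanSpace ℝ (Fin n)) ∞ (fun x =>
      (tangentMapWithin (𝓡 n) (𝓡 n) φ φ.source
        (⟨φ.symm x, S.anchor (φ.symm x) (S.input A (φ.symm x))⟩ : TangentBundle (𝓡 n) Q)).2)
      φ.target :=
    (contMDiff_snd_tangentBundle_modelSpace (EuclideanSpace ℝ (Fin n)) (𝓡 n)).comp_contMDiffOn
      (h2.comp h1 fun x hx => φ.map_target hx)
  have h4 := (contMDiffOn_iff_contDiffOn.1 h3)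
  refine ((EuclideanSpace.proj (𝕜 := ℝ) i).contDiff.comp_contDiffOn h4).congr fun x hx => ?_
  have hx' := φ.map_target hx
  have e : mfderivWithin (𝓡 n) (𝓡 n) φ φ.source (φ.symm x) = mfderiv (𝓡 n) (𝓡 n) φ (φ.symm x) :=
    mfderivWithin_of_isOpen φ.open_source hx'
  change _ = (show EuclideanSpace ℝ (Fin n) from
    mfderivWithin (𝓡 n) (𝓡 n) φ φ.source (φ.symm x) _) i
  rw [e]
  rfl

/-- The constraint `R(q, y)^i = ρ^i_A(q) y^A` in coordinates. -/
noncomputable def velocityField (S : System n m Q D)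
    (φ : OpenPartialHomeomorph Q (EuclideanSpace ℝ (Fin n)))
    (z : EuclideanSpace ℝ (Fin n) × (Fin m → ℝ)) : EuclideanSpace ℝ (Fin n) :=
  WithLp.toLp 2 fun i => ∑ A, S.anchorCoeff φ A i z.1 * z.2 A

@[simp] theorem velocityField_apply (z : EuclideanSpace ℝ (Fin n) × (Fin m → ℝ)) (i : Fin n) :
    S.velocityField φ z i = ∑ A, S.anchorCoeff φ A i z.1 * z.2 A := rfl

theorem contDiffOn_velocityField (hφ : φ ∈ IsManifold.maximalAtlas (𝓡 n) ∞ Q) :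
    ContDiffOn ℝ 1 (S.velocityField φ) (φ.target ×ˢ univ) := by
  refine (contDiffOn_piLp 2).2 fun i => ?_
  simp only [velocityField_apply]
  refine ContDiffOn.sum (𝕜 := ℝ) (f := fun A (z : EuclideanSpace ℝ (Fin n) × (Fin m → ℝ)) =>
    S.anchorCoeff φ A i z.1 * z.2 A) fun A _ => ?_
  have h₁ : ContDiffOn ℝ 1 (fun z : EuclideanSpace ℝ (Fin n) × (Fin m → ℝ) =>
      S.anchorCoeff φ A i z.1) (φ.target ×ˢ univ) :=
    ((S.contDiffOn_anchorCoeff hφ A i).of_le (by simp)).comp contDiffOn_fst fun z hz => hz.1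
  exact h₁.mul (by fun_prop)

theorem anchorCoeff_chart (A : Fin m) (i : Fin n) {q : Q} (hq : q ∈ φ.source) :
    S.anchorCoeff φ A i (φ q) = (show EuclideanSpace ℝ (Fin n) from
      mfderiv (𝓡 n) (𝓡 n) φ q (S.anchor q (S.input A q))) i := by
  unfold anchorCoeff
  rw [φ.left_inv hq]

theorem mfderiv_chart_anchor (v : TotalSpace (EuclideanSpace ℝ (Fin m)) D)
    (hv : v.proj ∈ φ.source) :
    (show EuclideanSpace ℝ (Fin n) from
      mfderiv (𝓡 n) (𝓡 n) φ v.proj (S.anchor v.proj v.snd))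
      = S.velocityField φ (φ v.proj, S.coord v) := by
  ext i
  have h : (show EuclideanSpace ℝ (Fin n) from
      mfderiv (𝓡 n) (𝓡 n) φ v.proj (S.anchor v.proj v.snd))
      = ∑ A, S.coord v A • (show EuclideanSpace ℝ (Fin n) from
        mfderiv (𝓡 n) (𝓡 n) φ v.proj (S.anchor v.proj (S.input A v.proj))) := by
    have := congrArg (fun w => mfderiv (𝓡 n) (𝓡 n) φ v.proj (S.anchor v.proj w))
      (S.sum_coord_smul v)
    simp only [map_sum, map_smul] at this
    exact this.symm
  have hsum : ∀ (c : Fin m → ℝ) (w : Fin m → EuclideanSpace ℝ (Fin n)),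
      (∑ A, c A • w A) i = ∑ A, w A i * c A := fun c w => by simp [mul_comm]
  refine (congrArg (fun w : EuclideanSpace ℝ (Fin n) => w i) h).trans ((hsum _ _).trans ?_)
  exact Finset.sum_congr rfl fun A _ => congrArg (· * S.coord v A) (S.anchorCoeff_chart A i hv).symm

theorem isAdmissible_iff (hφ : φ ∈ IsManifold.maximalAtlas (𝓡 n) ∞ Q) {T : ℝ}
    {γ : ℝ → TotalSpace (EuclideanSpace ℝ (Fin m)) D}
    (hγ : ∀ t ∈ Icc 0 T, (γ t).proj ∈ φ.source) :
    S.IsAdmissible T γ ↔ ∀ t ∈ Icc 0 T, HasDerivWithinAt (basePath φ γ)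
      (S.velocityField φ (basePath φ γ t, S.coord (γ t))) (Icc 0 T) t := by
  refine forall₂_congr fun t ht => ?_
  rw [hasMFDerivWithinAt_curve_iff hφ hγ ht, S.mfderiv_chart_anchor _ (hγ t ht)]
  rfl

section Curves

variable {T : ℝ} {γ : ℝ → TotalSpace (EuclideanSpace ℝ (Fin m)) D}

theorem contDiffOn_coord (hγ : IsC1 (n := n) T γ) :
    ContDiffOn ℝ 1 (fun t => S.coord (γ t)) (Icc 0 T) :=
  contMDiffOn_iff_contDiffOn.1 ((S.contMDiff_coord.of_le (by simp)).comp_contMDiffOn hγ)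

theorem isC1_point (hφ : φ ∈ IsManifold.maximalAtlas (𝓡 n) ∞ Q) {x : ℝ → EuclideanSpace ℝ (Fin n)}
    {y : ℝ → Fin m → ℝ} (hx : ContDiffOn ℝ 1 x (Icc 0 T)) (hy : ContDiffOn ℝ 1 y (Icc 0 T))
    (hs : ∀ t ∈ Icc 0 T, x t ∈ φ.target) :
    IsC1 (n := n) T (fun t => S.point (φ.symm (x t)) (y t)) := by
  have h1 : ContMDiffOn 𝓘(ℝ, ℝ) (𝓡 n) 1 (fun t => φ.symm (x t)) (Icc 0 T) :=
    ((contMDiffOn_symm_of_mem_maximalAtlas hφ).of_le (by simp)).comp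
      (contMDiffOn_iff_contDiffOn.2 hx) hs
  have h2 := h1.prodMk (contMDiffOn_iff_contDiffOn.2 hy)
  exact (S.contMDiff_point.of_le (by simp)).comp_contMDiffOn h2

/-- The equation of motion, solved for the control. -/
theorem motion_iff {t : ℝ} {u : Fin m → ℝ} :
    S.accel T γ t + S.gradV (γ t).proj = ∑ A, u A • S.input A (γ t).proj ↔
      u = S.elimControl (γ t).proj (S.coord (γ t)) (S.ydot T γ t) := by
  rw [← (S.frame (γ t).proj).repr.injective.eq_iff]
  have hu : ∀ C, (S.frame (γ t).proj).repr (∑ A, u A • S.input A (γ t).proj) C = u C :=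
    S.frame_repr_sum _ u
  have ha : ∀ C, (S.frame (γ t).proj).repr (S.accel T γ t + S.gradV (γ t).proj) C
      = S.elimControl (γ t).proj (S.coord (γ t)) (S.ydot T γ t) C := by
    intro C
    simp only [accel, map_add, Finsupp.add_apply, elimControl]
    congr 2
    · exact S.frame_repr_sum _ _ C
    · simp only [map_sum, map_smul, Finsupp.finsetSum_apply, Finsupp.smul_apply, smul_eq_mul,
        christoffel]
      refine Finset.sum_congr rfl fun A _ => Finset.sum_congr rfl fun B _ => ?_
      ring
  constructor
  · intro h
    funext C
    rw [← hu, ← h, ha]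
  · intro h
    ext C
    rw [hu, ha, h]

end Curves

section Lagrangian

variable {U : Set (Fin m → ℝ)} {C : TotalSpace (EuclideanSpace ℝ (Fin m)) D × (Fin m → ℝ) → ℝ}

/-- The coordinates `(q, y, ẏ)` over the chart `φ` whose eliminated control lies in `U`. -/
def controlDomain (S : System n m Q D) (φ : OpenPartialHomeomorph Q (EuclideanSpace ℝ (Fin n)))
    (U : Set (Fin m → ℝ)) : Set (EuclideanSpace ℝ (Fin n) × (Fin m → ℝ) × (Fin m → ℝ)) :=
  {z | z.1 ∈ φ.target ∧ S.elimControl (φ.symm z.1) z.2.1 z.2.2 ∈ U}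

theorem contMDiffOn_elimControl_chart (hφ : φ ∈ IsManifold.maximalAtlas (𝓡 n) ∞ Q) :
    ContMDiffOn 𝓘(ℝ, EuclideanSpace ℝ (Fin n) × (Fin m → ℝ) × (Fin m → ℝ)) 𝓘(ℝ, Fin m → ℝ) ∞
      (fun z : EuclideanSpace ℝ (Fin n) × (Fin m → ℝ) × (Fin m → ℝ) =>
        S.elimControl (φ.symm z.1) z.2.1 z.2.2) {z | z.1 ∈ φ.target} :=
  S.contMDiff_elimControl.comp_contMDiffOn
    ((contMDiffOn_chart_symm_fst hφ).prodMk (contMDiffOn_iff_contDiffOn.2 contDiffOn_snd))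

theorem contMDiffOn_point_chart (hφ : φ ∈ IsManifold.maximalAtlas (𝓡 n) ∞ Q) :
    ContMDiffOn 𝓘(ℝ, EuclideanSpace ℝ (Fin n) × (Fin m → ℝ) × (Fin m → ℝ))
      ((𝓡 n).prod 𝓘(ℝ, EuclideanSpace ℝ (Fin m))) ∞
      (fun z : EuclideanSpace ℝ (Fin n) × (Fin m → ℝ) × (Fin m → ℝ) =>
        S.point (φ.symm z.1) z.2.1) {z | z.1 ∈ φ.target} :=
  S.contMDiff_point.comp_contMDiffOn ((contMDiffOn_chart_symm_fst hφ).prodMk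
    (contMDiffOn_iff_contDiffOn.2 (contDiff_fst.comp contDiff_snd).contDiffOn))

theorem isOpen_controlDomain (hφ : φ ∈ IsManifold.maximalAtlas (𝓡 n) ∞ Q) (hU : IsOpen U) :
    IsOpen (S.controlDomain φ U) :=
  (S.contMDiffOn_elimControl_chart hφ).continuousOn.isOpen_inter_preimage
    (φ.open_target.preimage continuous_fst) hU

theorem contDiffOn_lagrangian (hφ : φ ∈ IsManifold.maximalAtlas (𝓡 n) ∞ Q)
    (hC : ContMDiffOn (((𝓡 n).prod 𝓘(ℝ, EuclideanSpace ℝ (Fin m))).prod 𝓘(ℝ, Fin m → ℝ))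
      𝓘(ℝ, ℝ) ∞ C (univ ×ˢ U)) :
    ContDiffOn ℝ 1 (fun z : EuclideanSpace ℝ (Fin n) × (Fin m → ℝ) × (Fin m → ℝ) =>
      S.lagrangian φ C z.1 z.2.1 z.2.2) (S.controlDomain φ U) := by
  have hsub : S.controlDomain φ U ⊆ {z | z.1 ∈ φ.target} := fun z hz => hz.1
  have h := hC.comp (((S.contMDiffOn_point_chart hφ).mono hsub).prodMk
    ((S.contMDiffOn_elimControl_chart hφ).mono hsub)) fun z hz => ⟨trivial, hz.2⟩
  exact (contMDiffOn_iff_contDiffOn.1 h).of_le (by simp)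

end Lagrangian

end System

end NonholonomicControl

namespace NonholonomicControl

/-- The pairing `(λ, w) ↦ λ_i w^i`. -/
noncomputable def pairing (n : ℕ) : (Fin n → ℝ) →L[ℝ] EuclideanSpace ℝ (Fin n) →L[ℝ] ℝ :=
  ∑ i, (ContinuousLinearMap.proj (R := ℝ) (φ := fun _ : Fin n => ℝ) i).smulRight
    (EuclideanSpace.proj (𝕜 := ℝ) i)

theorem pairing_apply {n : ℕ} (l : Fin n → ℝ) (w : EuclideanSpace ℝ (Fin n)) :
    pairing n l w = ∑ i, l i * w i := by
  simp [pairing]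

theorem pairing_single {n : ℕ} (l : Fin n → ℝ) (i : Fin n) :
    pairing n l (EuclideanSpace.single i 1) = l i := by
  simp [pairing_apply]

theorem pairing_components {n : ℕ} (f : EuclideanSpace ℝ (Fin n) →L[ℝ] ℝ) :
    pairing n (fun i => f (EuclideanSpace.single i 1)) = f := by
  ext w
  conv_rhs => rw [← (EuclideanSpace.basisFun (Fin n) ℝ).sum_repr w, map_sum]
  simp [pairing_apply, mul_comm]

theorem eq_zero_of_pairing_eq_zero {n : ℕ} {a : EuclideanSpace ℝ (Fin n)}
    (h : ∀ p, pairing n p a = 0) : a = 0 := by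
  ext i
  simpa [pairing_apply, Pi.single_apply] using h (Pi.single i 1)

section PartialDerivatives

variable {X Y Z F : Type*} [NormedAddCommGroup X] [NormedSpace ℝ X] [NormedAddCommGroup Y]
  [NormedSpace ℝ Y] [NormedAddCommGroup Z] [NormedSpace ℝ Z] [NormedAddCommGroup F]
  [NormedSpace ℝ F]

theorem fderiv_partial_fst {f : X × Y → F} {x : X} {y : Y} (hf : DifferentiableAt ℝ f (x, y))
    (e : X) : fderiv ℝ (fun x => f (x, y)) x e = fderiv ℝ f (x, y) (e, 0) := by
  have h₁ : HasFDerivAt (fun x => (x, y)) ((ContinuousLinearMap.id ℝ X).prod 0) x :=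
    (hasFDerivAt_id x).prodMk (hasFDerivAt_const y x)
  have h := HasFDerivAt.comp (g := f) x hf.hasFDerivAt h₁
  exact (DFunLike.congr_fun h.fderiv e).trans (by simp)

theorem fderiv_partial_snd {f : X × Y → F} {x : X} {y : Y} (hf : DifferentiableAt ℝ f (x, y))
    (e : Y) : fderiv ℝ (fun y => f (x, y)) y e = fderiv ℝ f (x, y) (0, e) := by
  have h := hf.hasFDerivAt.comp y ((hasFDerivAt_const x y).prodMk (hasFDerivAt_id y))
  exact (DFunLike.congr_fun h.fderiv e).trans (by simp)

theorem fderiv_partial_mid {f : X × Y × Z → F} {x : X} {y : Y} {z : Z}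
    (hf : DifferentiableAt ℝ f (x, y, z)) (e : Y) :
    fderiv ℝ (fun y => f (x, y, z)) y e = fderiv ℝ f (x, y, z) (0, e, 0) := by
  have h₁ : HasFDerivAt (fun y => (x, y, z))
      ((0 : Y →L[ℝ] X).prod ((ContinuousLinearMap.id ℝ Y).prod 0)) y :=
    (hasFDerivAt_const x y).prodMk ((hasFDerivAt_id y).prodMk (hasFDerivAt_const z y))
  have h := HasFDerivAt.comp (g := f) y hf.hasFDerivAt h₁
  exact (DFunLike.congr_fun h.fderiv e).trans (by simp)

theorem fderiv_partial_last {f : X × Y × Z → F} {x : X} {y : Y} {z : Z}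
    (hf : DifferentiableAt ℝ f (x, y, z)) (e : Z) :
    fderiv ℝ (fun z => f (x, y, z)) z e = fderiv ℝ f (x, y, z) (0, 0, e) := by
  have h₁ : HasFDerivAt (fun z => (x, y, z))
      ((0 : Z →L[ℝ] X).prod ((0 : Z →L[ℝ] Y).prod (ContinuousLinearMap.id ℝ Z))) z :=
    (hasFDerivAt_const x z).prodMk ((hasFDerivAt_const y z).prodMk (hasFDerivAt_id z))
  have h := HasFDerivAt.comp (g := f) z hf.hasFDerivAt h₁
  exact (DFunLike.congr_fun h.fderiv e).trans (by simp)

end PartialDerivatives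

variable {n m : ℕ} {Q : Type*} [TopologicalSpace Q] [ChartedSpace (EuclideanSpace ℝ (Fin n)) Q]
    [IsManifold (𝓡 n) ∞ Q]
    {D : Q → Type*} [TopologicalSpace (TotalSpace (EuclideanSpace ℝ (Fin m)) D)]
    [∀ x, AddCommGroup (D x)] [∀ x, Module ℝ (D x)] [∀ x, TopologicalSpace (D x)]
    [FiberBundle (EuclideanSpace ℝ (Fin m)) D] [VectorBundle ℝ (EuclideanSpace ℝ (Fin m)) D]
    [ContMDiffVectorBundle ∞ (EuclideanSpace ℝ (Fin m)) D (𝓡 n)]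

namespace System

variable (S : System n m Q D) {φ : OpenPartialHomeomorph Q (EuclideanSpace ℝ (Fin n))}
  {U : Set (Fin m → ℝ)} {C : TotalSpace (EuclideanSpace ℝ (Fin m)) D × (Fin m → ℝ) → ℝ}
  {T : ℝ} {γ : ℝ → TotalSpace (EuclideanSpace ℝ (Fin m)) D}

/-- The Lagrangian as a function on `X × Y × Y`. -/
noncomputable def lagrangianFun (S : System n m Q D)
    (φ : OpenPartialHomeomorph Q (EuclideanSpace ℝ (Fin n)))
    (C : TotalSpace (EuclideanSpace ℝ (Fin m)) D × (Fin m → ℝ) → ℝ)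
    (z : EuclideanSpace ℝ (Fin n) × (Fin m → ℝ) × (Fin m → ℝ)) : ℝ :=
  S.lagrangian φ C z.1 z.2.1 z.2.2

/-- The coordinates `(q, y, ẏ)` of the lift of `γ`. -/
noncomputable def lift (S : System n m Q D)
    (φ : OpenPartialHomeomorph Q (EuclideanSpace ℝ (Fin n))) (T : ℝ)
    (γ : ℝ → TotalSpace (EuclideanSpace ℝ (Fin m)) D) (t : ℝ) :
    EuclideanSpace ℝ (Fin n) × (Fin m → ℝ) × (Fin m → ℝ) :=
  (basePath φ γ t, S.coord (γ t), S.ydot T γ t)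

/-- The coordinates `(q, y)` of `γ`. -/
noncomputable def coordPath (S : System n m Q D)
    (φ : OpenPartialHomeomorph Q (EuclideanSpace ℝ (Fin n)))
    (γ : ℝ → TotalSpace (EuclideanSpace ℝ (Fin m)) D) (t : ℝ) :
    EuclideanSpace ℝ (Fin n) × (Fin m → ℝ) :=
  (basePath φ γ t, S.coord (γ t))

/-- A `C¹` curve over the chart `φ` whose eliminated control takes values in `U`. -/
structure IsControlledCurve (S : System n m Q D)
    (φ : OpenPartialHomeomorph Q (EuclideanSpace ℝ (Fin n))) (U : Set (Fin m → ℝ)) (T : ℝ)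
    (γ : ℝ → TotalSpace (EuclideanSpace ℝ (Fin m)) D) : Prop where
  isC1 : IsC1 (n := n) T γ
  source : ∀ t ∈ Icc 0 T, (γ t).proj ∈ φ.source
  control : ∀ t ∈ Icc 0 T, S.elimControl (γ t).proj (S.coord (γ t)) (S.ydot T γ t) ∈ U

namespace IsControlledCurve

variable {S}

theorem lift_mem (hγ : S.IsControlledCurve φ U T γ)
    {t : ℝ} (ht : t ∈ Icc 0 T) : S.lift φ T γ t ∈ S.controlDomain φ U := by
  refine ⟨φ.map_source (hγ.source t ht), ?_⟩
  simp only [lift, basePath, φ.left_inv (hγ.source t ht)]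
  exact hγ.control t ht

theorem coordPath_mem (hγ : S.IsControlledCurve φ U T γ) {t : ℝ} (ht : t ∈ Icc 0 T) :
    S.coordPath φ γ t ∈ φ.target ×ˢ (univ : Set (Fin m → ℝ)) :=
  ⟨φ.map_source (hγ.source t ht), trivial⟩

theorem contDiffOn_base (hγ : S.IsControlledCurve φ U T γ)
    (hφ : φ ∈ IsManifold.maximalAtlas (𝓡 n) ∞ Q) :
    ContDiffOn ℝ 1 (basePath φ γ) (Icc 0 T) :=
  contDiffOn_chart_comp hφ ((contMDiff_proj D).comp_contMDiffOn hγ.isC1) hγ.source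

theorem hasDerivWithinAt_base (hγ : S.IsControlledCurve φ U T γ)
    (hφ : φ ∈ IsManifold.maximalAtlas (𝓡 n) ∞ Q) {t : ℝ}
    (ht : t ∈ Icc 0 T) :
    HasDerivWithinAt (basePath φ γ) (derivWithin (basePath φ γ) (Icc 0 T) t) (Icc 0 T) t :=
  ((hγ.contDiffOn_base hφ).differentiableOn one_ne_zero t ht).hasDerivWithinAt

theorem hasDerivWithinAt_coord (hγ : S.IsControlledCurve φ U T γ) {t : ℝ} (ht : t ∈ Icc 0 T) :
    HasDerivWithinAt (fun s => S.coord (γ s)) (S.ydot T γ t) (Icc 0 T) t :=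
  ((S.contDiffOn_coord hγ.isC1).differentiableOn one_ne_zero t ht).hasDerivWithinAt

theorem continuousOn_ydot (hγ : S.IsControlledCurve φ U T γ)
    (hT : 0 < T) : ContinuousOn (S.ydot T γ) (Icc 0 T) :=
  ((contDiffOn_one_iff_derivWithin (uniqueDiffOn_Icc hT)).1 (S.contDiffOn_coord hγ.isC1)).2

theorem continuousOn_coordPath (hγ : S.IsControlledCurve φ U T γ)
    (hφ : φ ∈ IsManifold.maximalAtlas (𝓡 n) ∞ Q) :
    ContinuousOn (S.coordPath φ γ) (Icc 0 T) :=
  (hγ.contDiffOn_base hφ).continuousOn.prodMk (S.contDiffOn_coord hγ.isC1).continuousOn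

theorem continuousOn_lift (hγ : S.IsControlledCurve φ U T γ)
    (hT : 0 < T) (hφ : φ ∈ IsManifold.maximalAtlas (𝓡 n) ∞ Q) :
    ContinuousOn (S.lift φ T γ) (Icc 0 T) :=
  (hγ.contDiffOn_base hφ).continuousOn.prodMk
    ((S.contDiffOn_coord hγ.isC1).continuousOn.prodMk (hγ.continuousOn_ydot hT))

theorem differentiableAt_velocityField (hγ : S.IsControlledCurve φ U T γ)
    (hφ : φ ∈ IsManifold.maximalAtlas (𝓡 n) ∞ Q) {t : ℝ}
    (ht : t ∈ Icc 0 T) : DifferentiableAt ℝ (S.velocityField φ) (S.coordPath φ γ t) :=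
  ((S.contDiffOn_velocityField hφ).differentiableOn one_ne_zero).differentiableAt
    ((φ.open_target.prod isOpen_univ).mem_nhds (hγ.coordPath_mem ht))

theorem differentiableAt_lagrangianFun (hγ : S.IsControlledCurve φ U T γ)
    (hφ : φ ∈ IsManifold.maximalAtlas (𝓡 n) ∞ Q)
    (hU : IsOpen U)
    (hC : ContMDiffOn (((𝓡 n).prod 𝓘(ℝ, EuclideanSpace ℝ (Fin m))).prod 𝓘(ℝ, Fin m → ℝ))
      𝓘(ℝ, ℝ) ∞ C (univ ×ˢ U)) {t : ℝ} (ht : t ∈ Icc 0 T) :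
    DifferentiableAt ℝ (S.lagrangianFun φ C) (S.lift φ T γ t) :=
  ((S.contDiffOn_lagrangian hφ hC).differentiableOn one_ne_zero).differentiableAt
    ((S.isOpen_controlDomain hφ hU).mem_nhds (hγ.lift_mem ht))

/-- Extremals are the curves that satisfy the constraint and the Euler-Lagrange equations. -/
theorem isExtremal_iff (hγ : S.IsControlledCurve φ U T γ)
    (hT : 0 < T) (hφ : φ ∈ IsManifold.maximalAtlas (𝓡 n) ∞ Q) (hU : IsOpen U)
    (hC : ContMDiffOn (((𝓡 n).prod 𝓘(ℝ, EuclideanSpace ℝ (Fin m))).prod 𝓘(ℝ, Fin m → ℝ))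
      𝓘(ℝ, ℝ) ∞ C (univ ×ˢ U)) (μ : ℝ) (lam : ℝ → Fin n → ℝ) :
    S.IsExtremal φ C μ T γ lam ↔ ContinuousOn lam (Icc 0 T) ∧ S.IsAdmissible T γ ∧
      EulerLagrange T (fun t => μ • fderiv ℝ (S.lagrangianFun φ C) (S.lift φ T γ t))
        (fun t => fderiv ℝ (S.velocityField φ) (S.coordPath φ γ t))
        (fun t => pairing n (lam t)) := by
  refine and_congr_right fun hlam => ?_
  set x := basePath φ γ
  set w := derivWithin x (Icc 0 T)
  have hw : ContinuousOn w (Icc 0 T) :=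
    ((contDiffOn_one_iff_derivWithin (uniqueDiffOn_Icc hT)).1 (hγ.contDiffOn_base hφ)).2
  have hΩ := S.isOpen_controlDomain hφ hU
  have hΘ : IsOpen (φ.target ×ˢ (univ : Set (Fin m → ℝ))) := φ.open_target.prod isOpen_univ
  have hL : ContDiffOn ℝ 1 (S.lagrangianFun φ C) (S.controlDomain φ U) :=
    S.contDiffOn_lagrangian hφ hC
  have hR := S.contDiffOn_velocityField hφ
  have hlift := hγ.continuousOn_lift hT hφ
  have hpath := hγ.continuousOn_coordPath hφ
  have haL : ContinuousOn (fun t => μ • fderiv ℝ (S.lagrangianFun φ C) (S.lift φ T γ t))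
      (Icc 0 T) :=
    ((hL.continuousOn_fderiv_of_isOpen hΩ le_rfl).comp hlift fun t ht =>
      hγ.lift_mem ht).const_smul μ
  have haR : ContinuousOn (fun t => fderiv ℝ (S.velocityField φ) (S.coordPath φ γ t)) (Icc 0 T) :=
    (hR.continuousOn_fderiv_of_isOpen hΘ le_rfl).comp hpath fun t ht => hγ.coordPath_mem ht
  have hr : ContinuousOn (fun t => w t - S.velocityField φ (S.coordPath φ γ t)) (Icc 0 T) :=
    hw.sub (hR.continuousOn.comp hpath fun t ht => hγ.coordPath_mem ht)
  have hadm : S.IsAdmissible T γ ↔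
      ∀ t ∈ Icc 0 T, w t - S.velocityField φ (S.coordPath φ γ t) = 0 := by
    rw [S.isAdmissible_iff hφ hγ.source]
    refine forall₂_congr fun t ht => ?_
    rw [sub_eq_zero]
    constructor
    · intro h
      exact h.derivWithin (uniqueDiffOn_Icc hT t ht)
    · intro h
      exact (hγ.hasDerivWithinAt_base hφ ht).congr_deriv h
  have hlam' : ContinuousOn (fun t => pairing n (lam t)) (Icc 0 T) :=
    (pairing n).continuous.comp_continuousOn hlam
  rw [hadm, ← eulerLagrange_iff_integral_eq_zero hT (B := pairing n)
    (fun a => eq_zero_of_pairing_eq_zero) haL haR hlam' hr]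
  refine forall_congr' fun δx => forall_congr' fun δy => forall_congr' fun δp =>
    forall_congr' fun hδx => forall_congr' fun hδy => forall_congr' fun hδp => ?_
  refine forall₄_congr fun _ _ _ _ => ?_
  have hdx : Continuous (deriv δx) := hδx.continuous_deriv le_rfl
  have hdy : Continuous (deriv δy) := hδy.continuous_deriv le_rfl
  have hc : ContinuousOn (fun t => (x t, S.coord (γ t), w t, S.ydot T γ t, lam t)) (Icc 0 T) :=
    (hγ.contDiffOn_base hφ).continuousOn.prodMk ((S.contDiffOn_coord hγ.isC1).continuousOn.prodMk
      (hw.prodMk ((hγ.continuousOn_ydot hT).prodMk hlam)))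
  have hδ : ContinuousOn (fun t => (δx t, δy t, deriv δx t, deriv δy t, δp t)) (Icc 0 T) :=
    (hδx.continuous.prodMk (hδy.continuous.prodMk
      (hdx.prodMk (hdy.prodMk hδp)))).continuousOn
  have hO : IsOpen {z : EuclideanSpace ℝ (Fin n) × (Fin m → ℝ) × EuclideanSpace ℝ (Fin n) ×
      (Fin m → ℝ) × (Fin n → ℝ) | (z.1, z.2.1, z.2.2.2.1) ∈ S.controlDomain φ U ∧
        (z.1, z.2.1) ∈ φ.target ×ˢ (univ : Set (Fin m → ℝ))} :=
    (hΩ.preimage (by fun_prop)).inter (hΘ.preimage (by fun_prop))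
  have key := hasDerivAt_integral_comp_add_smul hT.le hO (contDiffOn_extended (pairing n) μ hL hR)
    hc hδ (fun t ht => ⟨hγ.lift_mem ht, hγ.coordPath_mem ht⟩)
  have e₁ : (fun ε : ℝ => S.extAction φ C μ T (fun t => x t + ε • δx t)
        (fun t => S.coord (γ t) + ε • δy t) (fun t => lam t + ε • δp t))
      = fun ε : ℝ => ∫ t in (0 : ℝ)..T, (fun z : EuclideanSpace ℝ (Fin n) × (Fin m → ℝ) ×
          EuclideanSpace ℝ (Fin n) × (Fin m → ℝ) × (Fin n → ℝ) =>
          μ * S.lagrangianFun φ C (z.1, z.2.1, z.2.2.2.1)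
            + pairing n z.2.2.2.2 (z.2.2.1 - S.velocityField φ (z.1, z.2.1)))
          ((x t, S.coord (γ t), w t, S.ydot T γ t, lam t)
            + ε • (δx t, δy t, deriv δx t, deriv δy t, δp t)) := by
    funext ε
    refine intervalIntegral.integral_congr fun t ht => ?_
    rw [uIcc_of_le hT.le] at ht
    have d₁ : derivWithin (fun t => x t + ε • δx t) (Icc 0 T) t = w t + ε • deriv δx t :=
      ((hγ.hasDerivWithinAt_base hφ ht).add
        ((hδx.differentiable one_ne_zero t).hasDerivAt.hasDerivWithinAt.const_smul ε)).derivWithin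
        (uniqueDiffOn_Icc hT t ht)
    have d₂ : derivWithin (fun t => S.coord (γ t) + ε • δy t) (Icc 0 T) t
        = S.ydot T γ t + ε • deriv δy t :=
      ((hγ.hasDerivWithinAt_coord ht).add
        ((hδy.differentiable one_ne_zero t).hasDerivAt.hasDerivWithinAt.const_smul ε)).derivWithin
        (uniqueDiffOn_Icc hT t ht)
    simp only [extLagrangian, d₁, d₂, pairing_apply]
    rfl
  have e₂ : ∫ t in (0 : ℝ)..T, fderiv ℝ (fun z : EuclideanSpace ℝ (Fin n) × (Fin m → ℝ) ×
          EuclideanSpace ℝ (Fin n) × (Fin m → ℝ) × (Fin n → ℝ) =>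
          μ * S.lagrangianFun φ C (z.1, z.2.1, z.2.2.2.1)
            + pairing n z.2.2.2.2 (z.2.2.1 - S.velocityField φ (z.1, z.2.1)))
          (x t, S.coord (γ t), w t, S.ydot T γ t, lam t)
          (δx t, δy t, deriv δx t, deriv δy t, δp t)
      = ∫ t in (0 : ℝ)..T, ((μ • fderiv ℝ (S.lagrangianFun φ C) (S.lift φ T γ t))
            (δx t, δy t, deriv δy t)
          + pairing n (δp t) (w t - S.velocityField φ (S.coordPath φ γ t))
          + pairing n (lam t) (deriv δx t
            - fderiv ℝ (S.velocityField φ) (S.coordPath φ γ t) (δx t, δy t))) := by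
    refine intervalIntegral.integral_congr fun t ht => ?_
    rw [uIcc_of_le hT.le] at ht
    exact fderiv_extended μ (hγ.differentiableAt_lagrangianFun hφ hU hC ht)
      (hγ.differentiableAt_velocityField hφ ht) _
  rw [e₂] at key
  rw [e₁]
  exact ⟨fun h => key.unique h, fun h => key.congr_deriv h⟩

/-- The necessary conditions are the Euler-Lagrange equations in components. -/
theorem necessaryConditions_iff (hγ : S.IsControlledCurve φ U T γ)
    (hφ : φ ∈ IsManifold.maximalAtlas (𝓡 n) ∞ Q) (hU : IsOpen U)
    (hC : ContMDiffOn (((𝓡 n).prod 𝓘(ℝ, EuclideanSpace ℝ (Fin m))).prod 𝓘(ℝ, Fin m → ℝ))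
      𝓘(ℝ, ℝ) ∞ C (univ ×ˢ U)) (lam : ℝ → Fin n → ℝ) :
    S.NecessaryConditions φ C T γ lam ↔ S.IsAdmissible T γ ∧
      EulerLagrange T (fun t => (1 : ℝ) • fderiv ℝ (S.lagrangianFun φ C) (S.lift φ T γ t))
        (fun t => fderiv ℝ (S.velocityField φ) (S.coordPath φ γ t))
        (fun t => pairing n (lam t)) := by
  have hadm : S.IsAdmissible T γ ↔ ∀ t ∈ Icc 0 T, ∀ i : Fin n,
      HasDerivWithinAt (fun s => basePath φ γ s i)
        (∑ A, S.anchorCoeff φ A i (basePath φ γ t) * S.coord (γ t) A) (Icc 0 T) t := by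
    rw [S.isAdmissible_iff hφ hγ.source]
    refine forall₂_congr fun t ht => ?_
    rw [hasDerivWithinAt_iff_hasFDerivWithinAt, hasFDerivWithinAt_euclidean]
    refine forall_congr' fun i => ?_
    rw [hasDerivWithinAt_iff_hasFDerivWithinAt]
    refine iff_of_eq (congrArg (HasFDerivWithinAt _ · _ _) ?_)
    ext
    simp
  have hdc : ∀ t ∈ Icc 0 T, ∀ A i, DifferentiableAt ℝ (S.anchorCoeff φ A i) (basePath φ γ t) :=
    fun t ht A i => ((S.contDiffOn_anchorCoeff hφ A i).differentiableOn (by simp)).differentiableAt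
      (φ.open_target.mem_nhds (φ.map_source (hγ.source t ht)))
  have hcomp : ∀ t ∈ Icc 0 T, ∀ j : Fin n, DifferentiableAt ℝ
      (fun z : EuclideanSpace ℝ (Fin n) × (Fin m → ℝ) => S.velocityField φ z j)
      (basePath φ γ t, S.coord (γ t)) ∧
      ∀ e, fderiv ℝ (S.velocityField φ) (S.coordPath φ γ t) e j =
        fderiv ℝ (fun z => S.velocityField φ z j) (basePath φ γ t, S.coord (γ t)) e := by
    intro t ht j
    have h := ((EuclideanSpace.proj (𝕜 := ℝ) j).hasFDerivAt
      (x := S.velocityField φ (S.coordPath φ γ t))).comp _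
      (hγ.differentiableAt_velocityField hφ ht).hasFDerivAt
    exact ⟨h.differentiableAt, fun e => (DFunLike.congr_fun h.fderiv e).symm⟩
  have hRx : ∀ t ∈ Icc 0 T, ∀ e : EuclideanSpace ℝ (Fin n),
      pairing n (lam t) (fderiv ℝ (S.velocityField φ) (S.coordPath φ γ t) (e, 0))
        = ∑ j, ∑ A, lam t j * fderiv ℝ (S.anchorCoeff φ A j) (basePath φ γ t) e
            * S.coord (γ t) A := by
    intro t ht e
    rw [pairing_apply]
    refine Finset.sum_congr rfl fun j _ => ?_
    rw [(hcomp t ht j).2, ← fderiv_partial_fst (hcomp t ht j).1]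
    have h : HasFDerivAt (fun x => ∑ A, S.anchorCoeff φ A j x * S.coord (γ t) A)
        (∑ A, S.coord (γ t) A • fderiv ℝ (S.anchorCoeff φ A j) (basePath φ γ t))
        (basePath φ γ t) :=
      HasFDerivAt.fun_sum fun A _ => (hdc t ht A j).hasFDerivAt.mul_const (S.coord (γ t) A)
    refine (congrArg (lam t j * ·) (DFunLike.congr_fun h.fderiv e)).trans ?_
    simp only [sum_apply, smul_apply, smul_eq_mul, Finset.mul_sum]
    exact Finset.sum_congr rfl fun A _ => by ring
  have hRy : ∀ t ∈ Icc 0 T, ∀ A : Fin m,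
      pairing n (lam t) (fderiv ℝ (S.velocityField φ) (S.coordPath φ γ t) (0, Pi.single A 1))
        = ∑ i, S.anchorCoeff φ A i (basePath φ γ t) * lam t i := by
    intro t ht A
    rw [pairing_apply]
    refine Finset.sum_congr rfl fun j _ => ?_
    rw [(hcomp t ht j).2, ← fderiv_partial_snd (hcomp t ht j).1]
    have h : HasFDerivAt (fun y : Fin m → ℝ => ∑ B, S.anchorCoeff φ B j (basePath φ γ t) * y B)
        (∑ B, S.anchorCoeff φ B j (basePath φ γ t) •
          ContinuousLinearMap.proj (R := ℝ) (φ := fun _ : Fin m => ℝ) B) (S.coord (γ t)) :=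
      HasFDerivAt.fun_sum fun B _ => (hasFDerivAt_apply B (S.coord (γ t))).const_mul _
    refine (congrArg (lam t j * ·) (DFunLike.congr_fun h.fderiv _)).trans ?_
    simp [sum_apply, Pi.single_apply, mul_comm]
  have hL := fun t ht => hγ.differentiableAt_lagrangianFun hφ hU hC (t := t) ht
  have hLx : ∀ t ∈ Icc 0 T, ∀ e, fderiv ℝ (fun x => S.lagrangian φ C x (S.coord (γ t))
      (S.ydot T γ t)) (basePath φ γ t) e
      = fderiv ℝ (S.lagrangianFun φ C) (S.lift φ T γ t) (e, 0, 0) := fun t ht e =>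
    fderiv_partial_fst (hL t ht) e
  have hLy : ∀ t ∈ Icc 0 T, ∀ e, fderiv ℝ (fun y => S.lagrangian φ C (basePath φ γ t) y
      (S.ydot T γ t)) (S.coord (γ t)) e
      = fderiv ℝ (S.lagrangianFun φ C) (S.lift φ T γ t) (0, e, 0) := fun t ht e =>
    fderiv_partial_mid (hL t ht) e
  have hLv : ∀ t ∈ Icc 0 T, ∀ e, fderiv ℝ (fun v => S.lagrangian φ C (basePath φ γ t)
      (S.coord (γ t)) v) (S.ydot T γ t) e
      = fderiv ℝ (S.lagrangianFun φ C) (S.lift φ T γ t) (0, 0, e) := fun t ht e =>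
    fderiv_partial_last (hL t ht) e
  constructor
  · intro h
    refine ⟨hadm.2 h.admissible_eq, fun t ht e => ?_, fun t ht e => ?_⟩
    · have h₁ : HasDerivWithinAt (fun s => pairing n (lam s))
          ((fderiv ℝ (S.lagrangianFun φ C) (S.lift φ T γ t)).comp (.inl ℝ _ _)
            - (pairing n (lam t)).comp ((fderiv ℝ (S.velocityField φ)
              (S.coordPath φ γ t)).comp (.inl ℝ _ _))) (Icc 0 T) t := by
        refine hasDerivWithinAt_clm_of_basis (EuclideanSpace.basisFun (Fin n) ℝ).toBasis
          fun i => ?_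
        have h₂ := h.multiplier_eq t ht i
        rw [hLx t ht, ← hRx t ht] at h₂
        simp only [OrthonormalBasis.coe_toBasis, EuclideanSpace.basisFun_apply, pairing_single]
        exact h₂
      refine (h₁.clm_apply (hasDerivWithinAt_const t (Icc 0 T) e)).congr_deriv ?_
      simp [Prod.mk_zero_zero]
    · have h₁ : HasDerivWithinAt (fun s => (fderiv ℝ (S.lagrangianFun φ C)
            (S.lift φ T γ s)).comp ((ContinuousLinearMap.inr ℝ _ _).comp (.inr ℝ _ _)))
          ((fderiv ℝ (S.lagrangianFun φ C) (S.lift φ T γ t)).comp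
              ((ContinuousLinearMap.inr ℝ _ _).comp (.inl ℝ _ _))
            - (pairing n (lam t)).comp ((fderiv ℝ (S.velocityField φ)
              (S.coordPath φ γ t)).comp (.inr ℝ _ _))) (Icc 0 T) t := by
        refine hasDerivWithinAt_clm_of_basis (Pi.basisFun ℝ (Fin m)) fun A => ?_
        have h₂ := (h.fibre_eq t ht A).congr (fun s hs => (hLv s hs _).symm) (hLv t ht _).symm
        rw [hLy t ht, ← hRy t ht] at h₂
        simp only [Pi.basisFun_apply]
        exact h₂
      refine (HasDerivWithinAt.congr (h₁.clm_apply (hasDerivWithinAt_const t (Icc 0 T) e))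
        (fun s _ => ?_) ?_).congr_deriv ?_ <;> simp [Prod.mk_zero_zero]
  · rintro ⟨ha, hEL⟩
    refine ⟨fun t ht i => ?_, fun t ht A => ?_, hadm.1 ha⟩
    · have h := hEL.base t ht (EuclideanSpace.single i 1)
      simp only [pairing_single, one_smul] at h
      rw [hLx t ht, ← hRx t ht]
      exact h
    · have h := hEL.fibre t ht (Pi.single A 1)
      simp only [one_smul] at h
      rw [hLy t ht, ← hRy t ht]
      exact h.congr (fun s hs => hLv s hs _) (hLv t ht _)

end IsControlledCurve

end System

end NonholonomicControl

namespace NonholonomicControl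

variable {n m : ℕ} {Q : Type*} [TopologicalSpace Q] [ChartedSpace (EuclideanSpace ℝ (Fin n)) Q]
    [IsManifold (𝓡 n) ∞ Q]
    {D : Q → Type*} [TopologicalSpace (TotalSpace (EuclideanSpace ℝ (Fin m)) D)]
    [∀ x, AddCommGroup (D x)] [∀ x, Module ℝ (D x)] [∀ x, TopologicalSpace (D x)]
    [FiberBundle (EuclideanSpace ℝ (Fin m)) D] [VectorBundle ℝ (EuclideanSpace ℝ (Fin m)) D]
    [ContMDiffVectorBundle ∞ (EuclideanSpace ℝ (Fin m)) D (𝓡 n)]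

namespace System

variable (S : System n m Q D) {φ : OpenPartialHomeomorph Q (EuclideanSpace ℝ (Fin n))}
  {U : Set (Fin m → ℝ)} {C : TotalSpace (EuclideanSpace ℝ (Fin m)) D × (Fin m → ℝ) → ℝ}
  {T : ℝ} {γ : ℝ → TotalSpace (EuclideanSpace ℝ (Fin m)) D} {u : ℝ → Fin m → ℝ}

/-- A solution of the constraint in coordinates determines a solution of the control problem. -/
theorem isSolution_point (hT : 0 < T) (hφ : φ ∈ IsManifold.maximalAtlas (𝓡 n) ∞ Q)
    {x : ℝ → EuclideanSpace ℝ (Fin n)} {y v : ℝ → Fin m → ℝ} (hv : ContinuousOn v (Icc 0 T))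
    (hx : ∀ t ∈ Icc 0 T, HasDerivWithinAt x (S.velocityField φ (x t, y t)) (Icc 0 T) t)
    (hy : ∀ t ∈ Icc 0 T, HasDerivWithinAt y (v t) (Icc 0 T) t)
    (hz : ∀ t ∈ Icc 0 T, (x t, y t, v t) ∈ S.controlDomain φ U) :
    S.IsSolution U T (fun t => S.point (φ.symm (x t)) (y t))
      (fun t => S.elimControl (φ.symm (x t)) (y t) (v t)) := by
  have hxs : ∀ t ∈ Icc 0 T, x t ∈ φ.target := fun t ht => (hz t ht).1
  have hxc : ContinuousOn x (Icc 0 T) := fun t ht => (hx t ht).continuousWithinAt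
  have hyc : ContinuousOn y (Icc 0 T) := fun t ht => (hy t ht).continuousWithinAt
  have hu := uniqueDiffOn_Icc hT
  have hRc : ContinuousOn (fun t => S.velocityField φ (x t, y t)) (Icc 0 T) :=
    (S.contDiffOn_velocityField hφ).continuousOn.comp (hxc.prodMk hyc) fun t ht =>
      ⟨hxs t ht, trivial⟩
  have hx1 : ContDiffOn ℝ 1 x (Icc 0 T) := (contDiffOn_one_iff_derivWithin hu).2
    ⟨fun t ht => (hx t ht).differentiableWithinAt,
      hRc.congr fun t ht => (hx t ht).derivWithin (hu t ht)⟩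
  have hy1 : ContDiffOn ℝ 1 y (Icc 0 T) := (contDiffOn_one_iff_derivWithin hu).2
    ⟨fun t ht => (hy t ht).differentiableWithinAt,
      hv.congr fun t ht => (hy t ht).derivWithin (hu t ht)⟩
  refine ⟨S.isC1_point hφ hx1 hy1 hxs, ?_, fun t ht => (hz t ht).2, fun t ht => ?_⟩
  · rw [S.isAdmissible_iff hφ fun t ht => φ.map_target (hxs t ht)]
    intro t ht
    have hb : ∀ s ∈ Icc 0 T, basePath φ (fun t => S.point (φ.symm (x t)) (y t)) s = x s :=
      fun s hs => φ.right_inv (hxs s hs)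
    rw [hb t ht, S.coord_point]
    exact (hx t ht).congr hb (hb t ht)
  · rw [S.motion_iff]
    have hd : S.ydot T (fun t => S.point (φ.symm (x t)) (y t)) t = v t := by
      simp only [ydot, S.coord_point]
      exact (hy t ht).derivWithin (hu t ht)
    rw [hd, S.coord_point]
    rfl

theorem IsSolution.control_eq (h : S.IsSolution U T γ u) {t : ℝ} (ht : t ∈ Icc 0 T) :
    u t = S.elimControl (γ t).proj (S.coord (γ t)) (S.ydot T γ t) :=
  S.motion_iff.1 (h.motion t ht)

theorem IsSolution.isControlledCurve (h : S.IsSolution U T γ u)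
    (hs : ∀ t ∈ Icc 0 T, (γ t).proj ∈ φ.source) : S.IsControlledCurve φ U T γ :=
  ⟨h.isC1, hs, fun t ht => h.control_eq S ht ▸ h.control_mem t ht⟩

theorem point_symm_basePath {t : ℝ} (ht : (γ t).proj ∈ φ.source) :
    S.point (φ.symm (basePath φ γ t)) (S.coord (γ t)) = γ t := by
  rw [basePath, φ.left_inv ht, S.point_coord]

/-- In coordinates, an optimal solution is a weak local minimizer of the action. -/
theorem IsOptimal.exists_weakLocalMin (hT : 0 < T) (hφ : φ ∈ IsManifold.maximalAtlas (𝓡 n) ∞ Q)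
    (hU : IsOpen U) (h : S.IsOptimal U C T γ u) (hs : ∀ t ∈ Icc 0 T, (γ t).proj ∈ φ.source) :
    ∃ δ > 0, ∀ (x' : ℝ → EuclideanSpace ℝ (Fin n)) (y' v' : ℝ → Fin m → ℝ),
      ContinuousOn v' (Icc 0 T) →
      (∀ t ∈ Icc 0 T, HasDerivWithinAt x' (S.velocityField φ (x' t, y' t)) (Icc 0 T) t) →
      (∀ t ∈ Icc 0 T, HasDerivWithinAt y' (v' t) (Icc 0 T) t) →
      x' 0 = basePath φ γ 0 → y' 0 = S.coord (γ 0) → x' T = basePath φ γ T →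
      y' T = S.coord (γ T) →
      (∀ t ∈ Icc 0 T, dist (x' t, y' t, v' t) (S.lift φ T γ t) < δ) →
      ∫ t in (0 : ℝ)..T, S.lagrangianFun φ C (S.lift φ T γ t)
        ≤ ∫ t in (0 : ℝ)..T, S.lagrangianFun φ C (x' t, y' t, v' t) := by
  obtain ⟨hsol, W, hW, hgraph, hmin⟩ := h
  have hγ := hsol.isControlledCurve S hs
  let G : ℝ × EuclideanSpace ℝ (Fin n) × (Fin m → ℝ) × (Fin m → ℝ) →
      ℝ × TotalSpace (EuclideanSpace ℝ (Fin m)) D × (Fin m → ℝ) := fun p =>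
    (p.1, S.point (φ.symm p.2.1) p.2.2.1, S.elimControl (φ.symm p.2.1) p.2.2.1 p.2.2.2)
  have hdom : IsOpen (Prod.snd ⁻¹' S.controlDomain φ U :
      Set (ℝ × EuclideanSpace ℝ (Fin n) × (Fin m → ℝ) × (Fin m → ℝ))) :=
    (S.isOpen_controlDomain hφ hU).preimage continuous_snd
  have hG : ContinuousOn G (Prod.snd ⁻¹' S.controlDomain φ U) :=
    continuousOn_fst.prodMk
      (((S.contMDiffOn_point_chart hφ).continuousOn.comp continuousOn_snd fun p hp => hp.1).prodMk
        ((S.contMDiffOn_elimControl_chart hφ).continuousOn.comp continuousOn_snd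
          fun p hp => hp.1))
  have hGγ : ∀ t ∈ Icc 0 T, G (t, S.lift φ T γ t) = (t, γ t, u t) := fun t ht => by
    simp only [G, lift, S.point_symm_basePath (hs t ht), hsol.control_eq S ht]
    rw [basePath, φ.left_inv (hs t ht)]
  obtain ⟨δ, hδ, hball⟩ := exists_forall_mem_of_dist_lt (hG.isOpen_inter_preimage hdom hW)
    (restrictIcc T (fun t => (t, S.lift φ T γ t))
      (continuousOn_id.prodMk (hγ.continuousOn_lift hT hφ)))
    fun t => ⟨hγ.lift_mem t.2, by
      simp only [restrictIcc_apply, mem_preimage, hGγ t t.2]; exact hgraph t t.2⟩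
  refine ⟨δ, hδ, fun x' y' v' hv' hx' hy' hx0 hy0 hxT hyT hd => ?_⟩
  have hmem : ∀ t ∈ Icc 0 T, (t, x' t, y' t, v' t) ∈ Prod.snd ⁻¹' S.controlDomain φ U ∩ G ⁻¹' W :=
    fun t ht => hball ⟨t, ht⟩ _ (by
      rw [restrictIcc_apply, Prod.dist_eq, dist_self]
      exact max_lt hδ (hd t ht))
  have hsol' := S.isSolution_point hT hφ hv' hx' hy' fun t ht => (hmem t ht).1
  have hle := hmin _ _ hsol'
    (by simp only [hx0, hy0]; exact S.point_symm_basePath (hs 0 (left_mem_Icc.2 hT.le)))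
    (by simp only [hxT, hyT]; exact S.point_symm_basePath (hs T (right_mem_Icc.2 hT.le)))
    fun t ht => (hmem t ht).2
  refine le_of_eq_of_le (intervalIntegral.integral_congr fun t ht => ?_) hle
  rw [uIcc_of_le hT.le] at ht
  exact congrArg (fun p => C p.2) (hGγ t ht)

/-- Optimal solutions are normal or abnormal extremals. -/
theorem IsOptimal.exists_extremal (hT : 0 < T) (hφ : φ ∈ IsManifold.maximalAtlas (𝓡 n) ∞ Q)
    (hU : IsOpen U)
    (hC : ContMDiffOn (((𝓡 n).prod 𝓘(ℝ, EuclideanSpace ℝ (Fin m))).prod 𝓘(ℝ, Fin m → ℝ))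
      𝓘(ℝ, ℝ) ∞ C (univ ×ˢ U))
    (h : S.IsOptimal U C T γ u) (hs : ∀ t ∈ Icc 0 T, (γ t).proj ∈ φ.source) :
    (∃ lam, S.IsNormalExtremal φ C T γ lam) ∨ (∃ lam, S.IsAbnormalExtremal φ C T γ lam) := by
  have hγ := h.1.isControlledCurve S hs
  have hadm := h.1.admissible
  obtain ⟨δ, hδ, hmin⟩ := h.exists_weakLocalMin S hT hφ hU hs
  obtain ⟨μ, lam, hμ, hlam, hEL⟩ := exists_eulerLagrange_of_weakLocalMin hT
    (S.isOpen_controlDomain hφ hU) (φ.open_target.prod isOpen_univ)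
    (L := S.lagrangianFun φ C) (S.contDiffOn_lagrangian hφ hC) (S.contDiffOn_velocityField hφ)
    (hγ.continuousOn_ydot hT) ((S.isAdmissible_iff hφ hs).1 hadm)
    (fun t ht => hγ.hasDerivWithinAt_coord ht) (fun t ht => hγ.lift_mem ht)
    (fun t ht => hγ.coordPath_mem ht) hδ hmin
  have hext : S.IsExtremal φ C μ T γ fun t i => lam t (EuclideanSpace.single i 1) := by
    refine (hγ.isExtremal_iff hT hφ hU hC μ _).2
      ⟨continuousOn_pi.2 fun i => hlam.clm_apply continuousOn_const, hadm, ?_⟩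
    simp only [pairing_components]
    exact hEL
  rcases hμ with rfl | ⟨rfl, hne⟩
  · exact Or.inl ⟨_, hext⟩
  · refine Or.inr ⟨_, hext, T, right_mem_Icc.2 hT.le, fun h0 => hne ?_⟩
    rw [← pairing_components (lam T), h0, map_zero]

/-- Normal extremals are the admissible curves that satisfy the necessary conditions. -/
theorem IsControlledCurve.isNormalExtremal_iff (hγ : S.IsControlledCurve φ U T γ) (hT : 0 < T)
    (hφ : φ ∈ IsManifold.maximalAtlas (𝓡 n) ∞ Q) (hU : IsOpen U)
    (hC : ContMDiffOn (((𝓡 n).prod 𝓘(ℝ, EuclideanSpace ℝ (Fin m))).prod 𝓘(ℝ, Fin m → ℝ))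
      𝓘(ℝ, ℝ) ∞ C (univ ×ˢ U)) (lam : ℝ → Fin n → ℝ) :
    S.IsNormalExtremal φ C T γ lam ↔
      S.IsAdmissible T γ ∧ S.NecessaryConditions φ C T γ lam := by
  refine (hγ.isExtremal_iff hT hφ hU hC 1 lam).trans ⟨fun h => ?_, fun h => ?_⟩
  · exact ⟨h.2.1, (hγ.necessaryConditions_iff hφ hU hC lam).2 h.2⟩
  · exact ⟨continuousOn_pi.2 fun i t ht => (h.2.multiplier_eq t ht i).continuousWithinAt,
      (hγ.necessaryConditions_iff hφ hU hC lam).1 h.2⟩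

end System

end NonholonomicControl

theorem mainTheorem1 {n m : ℕ} {Q : Type*} [TopologicalSpace Q] [T2Space Q] [SecondCountableTopology Q]
    [ChartedSpace (EuclideanSpace ℝ (Fin n)) Q] [IsManifold (𝓡 n) ∞ Q]
    {D : Q → Type*} [TopologicalSpace (TotalSpace (EuclideanSpace ℝ (Fin m)) D)]
    [∀ x, AddCommGroup (D x)] [∀ x, Module ℝ (D x)] [∀ x, TopologicalSpace (D x)]
    [FiberBundle (EuclideanSpace ℝ (Fin m)) D] [VectorBundle ℝ (EuclideanSpace ℝ (Fin m)) D]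
    [ContMDiffVectorBundle ∞ (EuclideanSpace ℝ (Fin m)) D (𝓡 n)]
    (S : NonholonomicControl.System n m Q D)
    (U : Set (Fin m → ℝ)) (hU : IsOpen U)
    (C : TotalSpace (EuclideanSpace ℝ (Fin m)) D × (Fin m → ℝ) → ℝ)
    (hC : ContMDiffOn (((𝓡 n).prod 𝓘(ℝ, EuclideanSpace ℝ (Fin m))).prod 𝓘(ℝ, Fin m → ℝ))
      𝓘(ℝ, ℝ) ∞ C (univ ×ˢ U))
    (T : ℝ) (hT : 0 < T)
    (φ : OpenPartialHomeomorph Q (EuclideanSpace ℝ (Fin n)))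
    (hφ : φ ∈ IsManifold.maximalAtlas (𝓡 n) ∞ Q) :
    -- normal extremals are exactly the admissible curves that satisfy the necessary conditions
    (∀ γ : ℝ → TotalSpace (EuclideanSpace ℝ (Fin m)) D,
      NonholonomicControl.System.IsC1 (n := n) T γ →
      (∀ t ∈ Icc 0 T, (γ t).proj ∈ φ.source) →
      (∀ t ∈ Icc 0 T, S.elimControl (γ t).proj (S.coord (γ t)) (S.ydot T γ t) ∈ U) →
      ∀ lam : ℝ → Fin n → ℝ,
        S.IsNormalExtremal φ C T γ lam ↔
          S.IsAdmissible T γ ∧ S.NecessaryConditions φ C T γ lam) ∧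
    -- solutions of the optimal control problem are extremals, normal or abnormal; those which are
    -- not abnormal satisfy the necessary conditions
    (∀ (γ : ℝ → TotalSpace (EuclideanSpace ℝ (Fin m)) D) (u : ℝ → Fin m → ℝ),
      S.IsOptimal U C T γ u →
      (∀ t ∈ Icc 0 T, (γ t).proj ∈ φ.source) →
      ((∃ lam, S.IsNormalExtremal φ C T γ lam) ∨ (∃ lam, S.IsAbnormalExtremal φ C T γ lam)) ∧
      ((¬ ∃ lam, S.IsAbnormalExtremal φ C T γ lam) →
        ∃ lam, S.NecessaryConditions φ C T γ lam)) := by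
  refine ⟨fun γ h1 hs hc lam =>
    NonholonomicControl.System.IsControlledCurve.isNormalExtremal_iff S ⟨h1, hs, hc⟩ hT hφ hU hC
      lam,
    fun γ u h hs => ?_⟩
  have hex := h.exists_extremal S hT hφ hU hC hs
  refine ⟨hex, fun hab => ?_⟩
  obtain ⟨lam, hlam⟩ := hex.resolve_right hab
  exact ⟨lam, (((h.1.isControlledCurve S hs).isNormalExtremal_iff S hT hφ hU hC lam).1 hlam).2⟩
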